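/- Consider the uplink of a multicell system with a central cell $0$ and $L\ge 1$ interfering cells $1,\dots,L$. Each cell has $N$ single-antenna users, and the base station of the central cell has $M\ge N$ antennas. For $l=0,\dots,L$ let $H_{0l}\in\mathbb C^{M\times N}$ be the fast fading matrix from the users of cell $l$ to this base station. All entries of all the $H_{0l}$ are independent, with independent real and imaginary parts that are Gaussian with mean $0$ and variance $1/2$. Let $\beta_{0cl}>0$ be the large scale fading coefficient between user $c$ of cell $l$ and base station $0$, and put $G_{0l}=H_{0l}\,\mathrm{diag}(\beta_{01l},\dots,\beta_{0Nl})^{1/2}$, with columns $g_{0cl}$. Let $p_{cl}$ be the transmit power of user $c$ of cell $l$, with $p_{cl}>0$ for $l\ge 1$, and let $n$ be a user of the central cell with $p_{n0}\ge 0$. Let $a_{0n0}$ be the $n$th column of the zero-forcing receiver $G_{00}(G_{00}^HG_{00})^{-1}$. The ergodic achievable uplink rate of user $n$ of the central cell (noise of unit variance) is $$R_{n0}=\mathbb E\left\{\log_2\left(1+\frac{p_{n0}}{\sum_{l=1}^L\sum_{c=1}^N p_{cl}\,|a_{0n0}^Hg_{0cl}|^2+\|a_{0n0}\|^2}\right)\right\}.$$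 Let $T=NL$, let $\zeta_k=p_{cl}\beta_{0cl}$ for $k=N(l-1)+c$ ($1\le l\le L$, $1\le c\le N$), and let $\mathcal A=\mathrm{diag}(\zeta_1,\dots,\zeta_T)$. Let $\zeta_{\langle1\rangle}>\dots>\zeta_{\langle\varrho\rangle}$ be the distinct diagonal elements of $\mathcal A$, with multiplicities $\tau_1,\dots,\tau_\varrho$. The characteristic coefficients $\lambda_{h,j}$ ($1\le h\le\varrho$, $1\le j\le\tau_h$) of $\mathcal A$ are the uniquely determined coefficients of the partial fraction expansion $$\det(I+\xi\mathcal A)^{-1}=\sum_{h=1}^{\varrho}\sum_{j=1}^{\tau_h}\frac{\lambda_{h,j}}{(1+\xi\zeta_{\langle h\rangle})^{j}}$$ (for all real $\xi$ for which $I+\xi\mathcal A$ is invertible). Put $\mathtt E_1(x)=\int_1^\infty t^{-1}e^{-xt}\,dt$ for $x>0$ and $$S=\sum_{h=1}^{\varrho}\sum_{j=1}^{\tau_h}\lambda_{h,j}\frac{(-1)^{j-1}\zeta_{\langle h\rangle}^{-j}}{(j-1)!}\left[e^{1/\zeta_{\langle h\rangle}}\,\mathtt E_1\!\left(\frac1{\zeta_{\langle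 h\rangle}}\right)-\sum_{m=0}^{j-2}(-1)^m\zeta_{\langle h\rangle}^{m+1}m!\right].$$ Then the expectation defining $R_{n0}$ is finite; if $v$ is a sum of $T$ independent exponential random variables with means $\zeta_1,\dots,\zeta_T$, then $$R_{n0}\le\log_2\bigl(1+p_{n0}\,\beta_{0n0}\,(M-N+1)\,\mathbb E[1/(v+1)]\bigr),\qquad \mathbb E[1/(v+1)]=S,$$ and hence $$R_{n0}\le\log_2\bigl(1+p_{n0}\,\beta_{0n0}\,(M-N+1)\,S\bigr).$$ -/

import Mathlib

open MeasureTheory ProbabilityTheory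

/-! ### Distinct diagonal elements and characteristic coefficients -/

/-- The set of values taken by the diagonal entries `ζ` of `diag (ζ 0, …, ζ (T - 1))`. -/
noncomputable def diagValues {T : ℕ} (ζ : Fin T → ℝ) : Finset ℝ := Finset.univ.image ζ

/-- The number of distinct diagonal elements of `diag ζ`. -/
noncomputable def numDistinct {T : ℕ} (ζ : Fin T → ℝ) : ℕ := (diagValues ζ).card

/-- The distinct diagonal elements of `diag ζ`, listed in decreasing order. -/
noncomputable def distinctVal {T : ℕ} (ζ : Fin T → ℝ) (h : Fin (numDistinct ζ)) : ℝ :=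
  (diagValues ζ).orderEmbOfFin rfl h.rev

/-- The multiplicity of the `h`-th distinct diagonal element of `diag ζ`. -/
noncomputable def mult {T : ℕ} (ζ : Fin T → ℝ) (h : Fin (numDistinct ζ)) : ℕ :=
  (Finset.univ.filter fun k => ζ k = distinctVal ζ h).card

/-- `c` is the family of coefficients of the partial fraction expansion of `det (I + ξ diag ζ)⁻¹`
as a function of `ξ`. The index `j : Fin (mult ζ h)` starts at `0`, so `c h j` is the coefficient
of the power `j + 1`. -/
def IsCharCoeff {T : ℕ} (ζ : Fin T → ℝ) (c : (h : Fin (numDistinct ζ)) → Fin (mult ζ h) → ℝ) :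
    Prop :=
  ∀ ξ : ℝ, (1 + ξ • Matrix.diagonal ζ).det ≠ 0 →
    ((1 + ξ • Matrix.diagonal ζ).det)⁻¹ =
      ∑ h, ∑ j : Fin (mult ζ h), c h j / (1 + ξ * distinctVal ζ h) ^ (j.1 + 1)

open Polynomial in
theorem existsUnique_partialFraction {ι : Type*} [Fintype ι] [DecidableEq ι] (a : ι → ℝ)
    (ha : ∀ i, 0 < a i) (hinj : Function.Injective a) (n : ι → ℕ)
    (hn : ∀ i, n i ≠ 0) [Nonempty ι] :
    ∃! c : (i : ι) → Fin (n i) → ℝ, ∀ ξ : ℝ, ∏ i, (1 + ξ * a i) ^ n i ≠ 0 →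
      (∏ i, (1 + ξ * a i) ^ n i)⁻¹ = ∑ i, ∑ j : Fin (n i), c i j / (1 + ξ * a i) ^ (j.1 + 1) := by
  set g : ι → ℝ[X] := fun i => X + C (a i)⁻¹ with hg
  have hmon : ∀ i ∈ Finset.univ, (g i).Monic := fun i _ => monic_X_add_C _
  have hdeg : ∀ i, (g i).degree = 1 := fun i => degree_X_add_C _
  have hcop : Set.Pairwise (Finset.univ : Finset ι) fun i j => IsCoprime (g i) (g j) := by
    intro i _ j _ hij
    have h := isCoprime_X_sub_C_of_isUnit_sub (a := -(a i)⁻¹) (b := -(a j)⁻¹) (by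
      rw [isUnit_iff_ne_zero]
      intro h
      exact hij (hinj (inv_injective (by linarith))))
    simpa [hg] using h
  have heval : ∀ ξ i, 1 + ξ * a i = a i * (g i).eval ξ := by
    intro ξ i
    have := (ha i).ne'
    simp [hg]; field_simp; ring
  -- the polynomial form of the expansion
  have key : ∀ c : (i : ι) → Fin (n i) → ℝ,
      (∀ ξ : ℝ, ∏ i, (1 + ξ * a i) ^ n i ≠ 0 →
        (∏ i, (1 + ξ * a i) ^ n i)⁻¹ =
          ∑ i, ∑ j : Fin (n i), c i j / (1 + ξ * a i) ^ (j.1 + 1)) ↔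
      C (∏ i, a i ^ n i)⁻¹ = 0 * (∏ i, g i ^ n i) + ∑ i, ∑ j : Fin (n i),
        C (c i j.rev / a i ^ (j.rev.1 + 1)) * g i ^ j.1 *
          ∏ k ∈ Finset.univ.erase i, g k ^ n k := by
    intro c
    have pt : ∀ ξ : ℝ, (∀ i, 1 + ξ * a i ≠ 0) →
        ((∏ i, (1 + ξ * a i) ^ n i)⁻¹ =
          ∑ i, ∑ j : Fin (n i), c i j / (1 + ξ * a i) ^ (j.1 + 1) ↔
        (C (∏ i, a i ^ n i)⁻¹ : ℝ[X]).eval ξ = (0 * (∏ i, g i ^ n i) + ∑ i, ∑ j : Fin (n i),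
        C (c i j.rev / a i ^ (j.rev.1 + 1)) * g i ^ j.1 *
          ∏ k ∈ Finset.univ.erase i, g k ^ n k).eval ξ) := by
      intro ξ hξ
      have hg0 : ∀ i, (g i).eval ξ ≠ 0 := fun i h => hξ i (by rw [heval, h, mul_zero])
      have hP : ∏ i, (g i).eval ξ ^ n i ≠ 0 :=
        Finset.prod_ne_zero_iff.2 fun i _ => pow_ne_zero _ (hg0 i)
      rw [← mul_left_inj' hP]
      simp only [eval_C, zero_mul, zero_add, eval_finsetSum, eval_mul, eval_pow, eval_prod]
      have e1 : (∏ i, (1 + ξ * a i) ^ n i)⁻¹ * ∏ i, (g i).eval ξ ^ n i = (∏ i, a i ^ n i)⁻¹ := by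
        simp_rw [heval, mul_pow, Finset.prod_mul_distrib]
        field_simp
      have e2 : (∑ i, ∑ j : Fin (n i), c i j / (1 + ξ * a i) ^ (j.1 + 1)) *
          ∏ i, (g i).eval ξ ^ n i = ∑ i, ∑ j : Fin (n i),
          c i j.rev / a i ^ (j.rev.1 + 1) * (g i).eval ξ ^ j.1 *
          ∏ k ∈ Finset.univ.erase i, (g k).eval ξ ^ n k := by
        rw [Finset.sum_mul]
        refine Finset.sum_congr rfl fun i _ => ?_
        rw [Finset.sum_mul, ← Equiv.sum_comp Fin.revPerm]
        refine Finset.sum_congr rfl fun j _ => ?_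
        rw [← Finset.mul_prod_erase _ _ (Finset.mem_univ i), heval, mul_pow, Fin.revPerm_apply]
        have h1 : n i = j.1 + (j.rev.1 + 1) := by
          have := j.2
          rw [Fin.val_rev]; omega
        have h2 : (g i).eval ξ ^ n i = (g i).eval ξ ^ j.1 * (g i).eval ξ ^ (j.rev.1 + 1) := by
          rw [← pow_add, ← h1]
        rw [h2]
        have h3 := pow_ne_zero (j.rev.1 + 1) (hg0 i)
        have h4 := pow_ne_zero (j.rev.1 + 1) (ha i).ne'
        field_simp
      rw [e1, e2]
    constructor
    · intro H
      refine Polynomial.eq_of_infinite_eval_eq _ _ ((Set.Ioi_infinite (0 : ℝ)).mono ?_)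
      intro ξ hξ
      have h0 : ∀ i, 1 + ξ * a i ≠ 0 := fun i => by
        have := mul_pos (Set.mem_Ioi.1 hξ) (ha i); positivity
      exact (pt ξ h0).1 (H ξ (Finset.prod_ne_zero_iff.2 fun i _ => pow_ne_zero _ (h0 i)))
    · intro H ξ hξ
      have h0 : ∀ i, 1 + ξ * a i ≠ 0 := fun i h =>
        Finset.prod_ne_zero_iff.1 hξ i (Finset.mem_univ i) (by rw [h, zero_pow (hn i)])
      exact (pt ξ h0).2 (by rw [← H])
  have hprod : (∏ i, g i ^ n i).Monic := monic_prod_of_monic _ _ fun i hi => (hmon i hi).pow _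
  simp only [key]
  obtain ⟨q, r, hr, hf⟩ := eq_quo_mul_prod_pow_add_sum_rem_mul_prod_pow
    (C (∏ i, a i ^ n i)⁻¹) hmon hcop n
  have hrC : ∀ i j, r i j = C ((r i j).coeff 0) := fun i j =>
    eq_C_of_degree_le_zero (Order.lt_succ_iff.1 (by
      have := hr i (Finset.mem_univ i) j
      rw [hdeg] at this
      exact this))
  have hnat : ∀ i k, (g i ^ k).natDegree = k := fun i k => by
    rw [natDegree_pow, natDegree_X_add_C, mul_one]
  have hE : ∀ i, (∏ k ∈ Finset.univ.erase i, g k ^ n k).Monic := fun i =>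
    monic_prod_of_monic _ _ fun k hk => (hmon k (Finset.mem_univ k)).pow _
  have hnatP : ∀ i, (∏ i, g i ^ n i).natDegree =
      n i + (∏ k ∈ Finset.univ.erase i, g k ^ n k).natDegree := fun i => by
    rw [← Finset.mul_prod_erase _ _ (Finset.mem_univ i),
      ((hmon i (Finset.mem_univ i)).pow _).natDegree_mul (hE i), hnat]
  have hadd : ∀ p q : ℝ[X], p.degree < (∏ i, g i ^ n i).degree →
      q.degree < (∏ i, g i ^ n i).degree → (p + q).degree < (∏ i, g i ^ n i).degree :=
    fun p q h1 h2 => (degree_add_le p q).trans_lt (max_lt h1 h2)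
  have hzero : (0 : ℝ[X]).degree < (∏ i, g i ^ n i).degree := by
    rw [degree_zero, bot_lt_iff_ne_bot, Ne, degree_eq_bot]
    exact hprod.ne_zero
  have hsum : (∑ i, ∑ j : Fin (n i), r i j * g i ^ j.1 *
      ∏ k ∈ Finset.univ.erase i, g k ^ n k).degree < (∏ i, g i ^ n i).degree := by
    refine Finset.sum_induction _ (fun p : ℝ[X] => p.degree < (∏ i, g i ^ n i).degree) hadd hzero
      fun i _ => Finset.sum_induction _ (fun p : ℝ[X] => p.degree < (∏ i, g i ^ n i).degree) hadd hzero
      fun j _ => degree_lt_degree ?_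
    rw [hrC, mul_assoc, hnatP i]
    refine (natDegree_C_mul_le _ _).trans_lt ?_
    rw [((hmon i (Finset.mem_univ i)).pow _).natDegree_mul (hE i), hnat]
    exact Nat.add_lt_add_right j.2 _
  have hconst : (C (∏ i, a i ^ n i)⁻¹ : ℝ[X]).degree < (∏ i, g i ^ n i).degree := by
    obtain ⟨i⟩ := ‹Nonempty ι›
    refine degree_lt_degree ?_
    rw [natDegree_C, hnatP i]
    have := hn i
    omega
  have hq : q = 0 := by
    have h1 := (div_modByMonic_unique (f := C (∏ i, a i ^ n i)⁻¹) q _ hprod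
      ⟨by rw [mul_comm, add_comm]; exact hf.symm, hsum⟩).1
    exact h1.symm.trans ((divByMonic_eq_zero_iff hprod).2 hconst)
  refine ⟨fun i j => (r i j.rev).coeff 0 * a i ^ (j.1 + 1), ?_, ?_⟩
  · rw [hq] at hf
    refine hf.trans (congrArg (0 * (∏ i, g i ^ n i) + ·) ?_)
    refine Finset.sum_congr rfl fun i _ => Finset.sum_congr rfl fun j _ => ?_
    have h1 := pow_ne_zero (j.rev.1 + 1) (ha i).ne'
    rw [mul_div_cancel_right₀ _ h1, Fin.rev_rev, ← hrC]
  · intro c hc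
    have := (quo_mul_prod_pow_add_sum_rem_mul_prod_pow_unique hmon hcop
      (r₁ := fun i j => C (c i j.rev / a i ^ (j.rev.1 + 1))) (r₂ := r)
      (fun i _ j => by rw [hdeg]; exact degree_C_lt) hr (hc.symm.trans hf)).2
    funext i j
    have h1 := congrFun (this i (Finset.mem_univ i)) j.rev
    simp only [Fin.rev_rev] at h1
    rw [← h1, coeff_C_zero, div_mul_cancel₀ _ (pow_ne_zero _ (ha i).ne')]

theorem distinctVal_mem {T : ℕ} (ζ : Fin T → ℝ) (h : Fin (numDistinct ζ)) :
    ∃ k, ζ k = distinctVal ζ h := by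
  simpa [diagValues, distinctVal] using Finset.orderEmbOfFin_mem (diagValues ζ) rfl h.rev

theorem det_one_add_smul_diagonal {T : ℕ} (ζ : Fin T → ℝ) (ξ : ℝ) :
    (1 + ξ • Matrix.diagonal ζ).det = ∏ h, (1 + ξ * distinctVal ζ h) ^ mult ζ h := by
  have h1 : (1 + ξ • Matrix.diagonal ζ) = Matrix.diagonal fun k => 1 + ξ * ζ k := by
    rw [← Matrix.diagonal_one, ← Matrix.diagonal_smul, Matrix.diagonal_add]
    rfl
  rw [h1, Matrix.det_diagonal, Finset.prod_comp (fun x => 1 + ξ * x) ζ]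
  symm
  refine Finset.prod_bij (fun h _ => distinctVal ζ h) ?_ ?_ ?_ ?_
  · intro h _
    exact Finset.orderEmbOfFin_mem (diagValues ζ) rfl h.rev
  · intro h _ h' _ e
    exact Fin.rev_injective (((diagValues ζ).orderEmbOfFin rfl).injective e)
  · intro x hx
    obtain ⟨i, hi⟩ : x ∈ Set.range ((diagValues ζ).orderEmbOfFin rfl) := by
      rw [Finset.range_orderEmbOfFin]; exact hx
    exact ⟨i.rev, Finset.mem_univ _, (congrArg _ (Fin.rev_rev i)).trans hi⟩
  · intro h _
    rfl

/-- The characteristic coefficients of a nonempty diagonal matrix with positive diagonal entries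
exist and are uniquely determined. -/
theorem existsUnique_isCharCoeff {T : ℕ} (hT : 0 < T) (ζ : Fin T → ℝ) (hζ : ∀ k, 0 < ζ k) :
    ∃! c, IsCharCoeff ζ c := by
  have hne : Nonempty (Fin (numDistinct ζ)) :=
    ⟨⟨0, Finset.card_pos.2 ⟨ζ ⟨0, hT⟩, Finset.mem_image_of_mem _ (Finset.mem_univ _)⟩⟩⟩
  have := existsUnique_partialFraction (distinctVal ζ)
    (fun h => by obtain ⟨k, hk⟩ := distinctVal_mem ζ h; exact hk ▸ hζ k)
    (fun h h' e => Fin.rev_injective (((diagValues ζ).orderEmbOfFin rfl).injective e))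
    (mult ζ) (fun h => by
      obtain ⟨k, hk⟩ := distinctVal_mem ζ h
      exact Finset.card_ne_zero_of_mem (Finset.mem_filter.2 ⟨Finset.mem_univ k, hk⟩))
  simpa only [IsCharCoeff, det_one_add_smul_diagonal] using this

/-- The characteristic coefficients of `diag ζ`: the family determined by `IsCharCoeff ζ`
(see `existsUnique_isCharCoeff`). -/
noncomputable def charCoeff {T : ℕ} (ζ : Fin T → ℝ) :
    (h : Fin (numDistinct ζ)) → Fin (mult ζ h) → ℝ :=
  Classical.epsilon (IsCharCoeff ζ)

theorem isCharCoeff_charCoeff {T : ℕ} (hT : 0 < T) (ζ : Fin T → ℝ) (hζ : ∀ k, 0 < ζ k) :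
    IsCharCoeff ζ (charCoeff ζ) :=
  Classical.epsilon_spec (existsUnique_isCharCoeff hT ζ hζ).exists

/-! ### The closed form -/

/-- The exponential integral of order `1`. -/
noncomputable def expIntegralE1 (x : ℝ) : ℝ := ∫ t in Set.Ioi (1 : ℝ), Real.exp (-x * t) / t

/-- The double sum over the distinct diagonal elements of `diag ζ` and over the powers
`1, …, mult ζ h`; the index `j` starts at `0` and stands for the power `j + 1`. -/
noncomputable def closedForm {T : ℕ} (ζ : Fin T → ℝ) : ℝ :=
  ∑ h, ∑ j : Fin (mult ζ h),
    charCoeff ζ h j * ((-1) ^ j.1 * (distinctVal ζ h)⁻¹ ^ (j.1 + 1) / (j.1.factorial : ℝ)) *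
      (Real.exp (1 / distinctVal ζ h) * expIntegralE1 (1 / distinctVal ζ h) -
        ∑ m ∈ Finset.range j.1, (-1) ^ m * distinctVal ζ h ^ (m + 1) * (m.factorial : ℝ))

/-- `E[1 / (v + 1)]` for `v` a sum of independent exponential random variables with means `ζ k`:
the joint law of the summands is the product of the exponential laws with rates `1 / ζ k`. -/
noncomputable def meanRecip {T : ℕ} (ζ : Fin T → ℝ) : ℝ :=
  ∫ ψ : Fin T → ℝ, 1 / (∑ k, ψ k + 1) ∂Measure.pi fun k => expMeasure (1 / ζ k)

/-! ### The uplink model -/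

/-- Rayleigh fast fading towards the central base station. `H l ω` is the `M × N` matrix of the
coefficients between the users of cell `l` and the antennas of the base station of cell `0`. All
coefficients are independent, with independent real and imaginary parts that are Gaussian with
mean `0` and variance `1 / 2`. -/
structure IsRayleigh {Ω : Type*} [MeasurableSpace Ω] (P : Measure Ω) {M N L : ℕ}
    (H : Fin (L + 1) → Ω → Matrix (Fin M) (Fin N) ℂ) : Prop where
  measurable : ∀ l m n, Measurable fun ω => H l ω m n
  iIndep : iIndepFun (fun (i : Fin (L + 1) × Fin M × Fin N) ω => H i.1 ω i.2.1 i.2.2) P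
  indep_re_im : ∀ l m n, IndepFun (fun ω => (H l ω m n).re) (fun ω => (H l ω m n).im) P
  law_re : ∀ l m n, P.map (fun ω => (H l ω m n).re) = gaussianReal 0 (1 / 2)
  law_im : ∀ l m n, P.map (fun ω => (H l ω m n).im) = gaussianReal 0 (1 / 2)

/-- The channel matrix `G = H D ^ (1 / 2)` with `D` the diagonal matrix of large scale fading
coefficients. -/
noncomputable def channel {M N : ℕ} (H : Matrix (Fin M) (Fin N) ℂ) (β : Fin N → ℝ) :
    Matrix (Fin M) (Fin N) ℂ :=
  H * Matrix.diagonal fun n => ((√(β n) : ℝ) : ℂ)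

/-- The zero-forcing receiver matrix `G (Gᴴ G)⁻¹`. -/
noncomputable def zfReceiver {M N : ℕ} (G : Matrix (Fin M) (Fin N) ℂ) :
    Matrix (Fin M) (Fin N) ℂ :=
  G * (G.conjTranspose * G)⁻¹

/-- The signal-to-interference-plus-noise ratio of user `n` of cell `0` with the zero-forcing
receiver, given the fast fading matrices `H l` of the cells `l = 0, …, L`, the powers `p c l` and
the large scale fading coefficients `β c l` between user `c` of cell `l` and base station `0`. -/
noncomputable def zfSINR {M N L : ℕ} (p β : Fin N → Fin (L + 1) → ℝ)
    (H : Fin (L + 1) → Matrix (Fin M) (Fin N) ℂ) (n : Fin N) : ℝ :=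
  let G : Fin (L + 1) → Matrix (Fin M) (Fin N) ℂ := fun l => channel (H l) fun c => β c l
  let a : Fin M → ℂ := (zfReceiver (G 0)).col n
  p n 0 / (∑ l : Fin L, ∑ c, p c l.succ * ‖star a ⬝ᵥ (G l.succ).col c‖ ^ 2 +
    ‖WithLp.toLp 2 a‖ ^ 2)

/-- The ergodic achievable uplink rate of user `n` of cell `0` with the zero-forcing receiver. -/
noncomputable def zfUplinkRate {Ω : Type*} [MeasurableSpace Ω] (P : Measure Ω) {M N L : ℕ}
    (p β : Fin N → Fin (L + 1) → ℝ) (H : Fin (L + 1) → Ω → Matrix (Fin M) (Fin N) ℂ)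
    (n : Fin N) : ℝ :=
  ∫ ω, Real.logb 2 (1 + zfSINR p β (fun l => H l ω) n) ∂P

/-- The products `ζ k = p c l * β c l` of all users `c` of the interfering cells `l = 1, …, L`,
enumerated by `k = N (l - 1) + c`. -/
def interference {N L : ℕ} (p β : Fin N → Fin (L + 1) → ℝ) (k : Fin (L * N)) : ℝ :=
  let l : Fin L := (finProdFinEquiv.symm k).1
  let c : Fin N := (finProdFinEquiv.symm k).2
  p c l.succ * β c l.succ

/-!
Given the channel `G` of the central cell, let `a` be the zero-forcing receiver of user `n`.
Dividing numerator and denominator by `‖a‖ ^ 2` gives `SINR = p ‖a‖⁻² / (v + 1)`, where `v` is the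
weighted sum of the powers `|uᴴ h|²` with `u = a / ‖a‖` over the interfering users. Since `u` is a
unit vector that is independent of the interfering channels, and the standard complex Gaussian law
is invariant under unit linear forms (`map_sum_mul_eq_complexGaussian`), the conditional mean of
`1 / (v + 1)` is `meanRecip`, whatever `a ≠ 0` is (`lintegral_interference`). This is seen on
Laplace transforms: `E[1 / (v + 1)] = ∫ exp (-s) E[exp (-s v)] ds` over `s > 0`, and both a
squared standard complex Gaussian modulus and an exponential variable of mean `1` have the Laplace
transform `1 / (1 + s)` (`lintegral_one_div_sum_add_one`).

As `a` is orthogonal to the channel vectors of the other users and has inner product `1` with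
`g n`, the number `‖a‖⁻²` is at most the squared length of the projection of `g n` to the orthogonal
complement of the other channel vectors. When `Gᴴ G` is invertible, this complement has dimension
`M - N + 1`, and given the other users each coordinate of the projection has mean square `β n`.
Hence `E ‖a‖⁻² ≤ β n (M - N + 1)` (`lintegral_inv_normSq_zfReceiver_le`); no almost sure
invertibility is needed, because a singular `Gᴴ G` gives `a = 0` and a vanishing SINR. Jensen's
inequality for the logarithm turns the bound on the mean SINR into the bound on the rate.

For the closed form, the partial fraction expansion of `∏ k, (1 + s ζ k)⁻¹` reduces
`∫ exp (-s) ∏ k, (1 + s ζ k)⁻¹ ds` to the integrals of `exp (-s) (1 + s z) ^ (-j)`. The case `j = 1`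
is an exponential integral after the substitution `t = 1 + s z`, and integration by parts gives the
recursion in `j` (`integral_exp_neg_mul_inv_pow`).
-/

/-! ### Laplace transforms and the mean of `1 / (v + 1)` -/

theorem integrableOn_exp_neg_mul_of_bounded {f : ℝ → ℝ} (hf : Measurable f)
    (hbd : ∀ s, 0 < s → |f s| ≤ 1) :
    IntegrableOn (fun s => Real.exp (-s) * f s) (Set.Ioi 0) := by
  have h1 : IntegrableOn (fun s : ℝ => Real.exp (-s)) (Set.Ioi 0) := by
    simpa using integrableOn_exp_mul_Ioi (a := -1) (by norm_num) 0
  refine Integrable.mono' h1 (by fun_prop) ?_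
  filter_upwards [ae_restrict_mem measurableSet_Ioi] with s hs
  rw [Real.norm_eq_abs, abs_mul, abs_of_pos (Real.exp_pos _)]
  exact mul_le_of_le_one_right (Real.exp_pos _).le (hbd s hs)

/-- The mean of `1 / (∑ k, V k + 1)` depends on the independent nonnegative variables `V k` only
through their Laplace transforms: write `1 / (v + 1) = ∫ exp (-s (v + 1)) ds` over `s > 0` and
exchange the order of integration. -/
theorem lintegral_one_div_sum_add_one {Ω ι : Type*} [MeasurableSpace Ω] [Fintype ι]
    {P : Measure Ω} [IsProbabilityMeasure P] {V : ι → Ω → ℝ} (hV : ∀ k, Measurable (V k))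
    (hind : iIndepFun V P) (hnn : ∀ k, ∀ᵐ ω ∂P, 0 ≤ V k ω) {ζ : ι → ℝ} (hζ : ∀ k, 0 ≤ ζ k)
    (hlap : ∀ k, ∀ s, 0 < s →
      ∫⁻ ω, ENNReal.ofReal (Real.exp (-(s * V k ω))) ∂P = ENNReal.ofReal (1 + s * ζ k)⁻¹) :
    ∫⁻ ω, ENNReal.ofReal (1 / (∑ k, V k ω + 1)) ∂P =
      ENNReal.ofReal (∫ s in Set.Ioi (0 : ℝ), Real.exp (-s) * ∏ k, (1 + s * ζ k)⁻¹) := by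
  have hprod : ∀ s : ℝ, 0 < s → ∀ k, 0 ≤ (1 + s * ζ k)⁻¹ ∧ (1 + s * ζ k)⁻¹ ≤ 1 := by
    intro s hs k
    have := mul_nonneg hs.le (hζ k)
    exact ⟨by positivity, inv_le_one_of_one_le₀ (by linarith)⟩
  have h1 : ∀ᵐ ω ∂P, ENNReal.ofReal (1 / (∑ k, V k ω + 1)) =
      ∫⁻ s in Set.Ioi (0 : ℝ), ENNReal.ofReal (Real.exp (-s)) *
        ∏ k, ENNReal.ofReal (Real.exp (-(s * V k ω))) := by
    filter_upwards [ae_all_iff.2 hnn] with ω hω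
    have hv : 0 ≤ ∑ k, V k ω := Finset.sum_nonneg fun k _ => hω k
    have e : ∀ s : ℝ, ENNReal.ofReal (Real.exp (-s)) *
        ∏ k, ENNReal.ofReal (Real.exp (-(s * V k ω))) =
        ENNReal.ofReal (Real.exp (-(∑ k, V k ω + 1) * s)) := by
      intro s
      rw [← ENNReal.ofReal_prod_of_nonneg (fun k _ => (Real.exp_pos _).le),
        ← ENNReal.ofReal_mul (Real.exp_pos _).le, ← Real.exp_sum, ← Real.exp_add]
      congr 2
      rw [Finset.sum_neg_distrib, ← Finset.mul_sum]
      ring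
    simp_rw [e]
    rw [← ofReal_integral_eq_lintegral_ofReal (integrableOn_exp_mul_Ioi (by linarith) 0)
      (Filter.Eventually.of_forall fun s => (Real.exp_pos _).le),
      integral_exp_mul_Ioi (by linarith)]
    rw [mul_zero, Real.exp_zero, neg_div_neg_eq]
  rw [lintegral_congr_ae h1, lintegral_lintegral_swap (by fun_prop),
    ofReal_integral_eq_lintegral_ofReal]
  · refine setLIntegral_congr_fun measurableSet_Ioi fun s hs => ?_
    have hs' : 0 < s := hs
    rw [lintegral_const_mul _ (by fun_prop), ENNReal.ofReal_mul (Real.exp_pos _).le,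
      ENNReal.ofReal_prod_of_nonneg (fun k _ => (hprod s hs' k).1)]
    congr 1
    rw [lintegral_prod_eq_prod_lintegral_of_indepFun Finset.univ
      (fun k ω => ENNReal.ofReal (Real.exp (-(s * V k ω))))
      (hind.comp (fun _ x => ENNReal.ofReal (Real.exp (-(s * x)))) (fun _ => by fun_prop))
      (fun k => by fun_prop)]
    exact Finset.prod_congr rfl fun k _ => hlap k s hs'
  · refine integrableOn_exp_neg_mul_of_bounded (by fun_prop) fun s hs => ?_
    rw [abs_of_nonneg (Finset.prod_nonneg fun k _ => (hprod s hs k).1)]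
    exact Finset.prod_le_one (fun k _ => (hprod s hs k).1) fun k _ => (hprod s hs k).2
  · filter_upwards [ae_restrict_mem measurableSet_Ioi] with s hs
    exact mul_nonneg (Real.exp_pos _).le (Finset.prod_nonneg fun k _ => (hprod s hs k).1)

theorem expMeasure_ae_nonneg (r : ℝ) : ∀ᵐ x ∂expMeasure r, 0 ≤ x := by
  rw [ae_iff]
  simp only [not_le]
  change (volume.withDensity (gammaPDF 1 r)) (Set.Iio 0) = 0
  rw [withDensity_apply _ measurableSet_Iio]
  exact lintegral_gammaPDF_of_nonpos le_rfl

theorem lintegral_exp_neg_mul_expMeasure {r s : ℝ} (hr : 0 < r) (hs : 0 < s) :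
    ∫⁻ x, ENNReal.ofReal (Real.exp (-(s * x))) ∂expMeasure r =
      ENNReal.ofReal (1 + s * (1 / r))⁻¹ := by
  have hm : Measurable (gammaPDF 1 r) := (measurable_gammaPDFReal 1 r).ennreal_ofReal
  change ∫⁻ x, ENNReal.ofReal (Real.exp (-(s * x))) ∂(volume.withDensity (gammaPDF 1 r)) = _
  rw [lintegral_withDensity_eq_lintegral_mul _ hm (by fun_prop)]
  -- the integrand is a multiple of the exponential density of rate `r + s`
  have e : ∀ x, (gammaPDF 1 r * fun x => ENNReal.ofReal (Real.exp (-(s * x)))) x =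
      ENNReal.ofReal (1 + s * (1 / r))⁻¹ * exponentialPDF (r + s) x := by
    intro x
    change exponentialPDF r x * _ = _
    rw [exponentialPDF_eq, exponentialPDF_eq, ← ENNReal.ofReal_mul (by positivity)]
    split_ifs with hx
    · rw [← ENNReal.ofReal_mul (by positivity)]
      congr 1
      have : Real.exp (-((r + s) * x)) = Real.exp (-(r * x)) * Real.exp (-(s * x)) := by
        rw [← Real.exp_add]; ring_nf
      rw [this]
      field_simp
    · simp
  simp_rw [e]
  have hm' : Measurable (exponentialPDF (r + s)) :=
    (measurable_exponentialPDFReal (r + s)).ennreal_ofReal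
  rw [lintegral_const_mul _ hm', lintegral_exponentialPDF_eq_one (by linarith), mul_one]

theorem isProbabilityMeasure_expMeasure_one_div {z : ℝ} (hz : 0 < z) :
    IsProbabilityMeasure (expMeasure (1 / z)) :=
  isProbabilityMeasure_gammaMeasure one_pos (one_div_pos.2 hz)

theorem pi_expMeasure_ae_nonneg {T : ℕ} {ζ : Fin T → ℝ} (hζ : ∀ k, 0 < ζ k) (k : Fin T) :
    ∀ᵐ ψ ∂Measure.pi (fun k => expMeasure (1 / ζ k)), 0 ≤ ψ k := by
  have := fun k => isProbabilityMeasure_expMeasure_one_div (hζ k)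
  exact (measurePreserving_eval (fun k => expMeasure (1 / ζ k)) k).quasiMeasurePreserving.ae
    (expMeasure_ae_nonneg _)

theorem meanRecip_nonneg {T : ℕ} {ζ : Fin T → ℝ} (hζ : ∀ k, 0 < ζ k) : 0 ≤ meanRecip ζ := by
  refine integral_nonneg_of_ae ?_
  filter_upwards [ae_all_iff.2 (pi_expMeasure_ae_nonneg hζ)] with ψ hψ
  have hv : 0 ≤ ∑ k, ψ k := Finset.sum_nonneg fun k _ => hψ k
  simp only [Pi.zero_apply]
  positivity

theorem meanRecip_eq_integral {T : ℕ} {ζ : Fin T → ℝ} (hζ : ∀ k, 0 < ζ k) :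
    meanRecip ζ = ∫ s in Set.Ioi (0 : ℝ), Real.exp (-s) * ∏ k, (1 + s * ζ k)⁻¹ := by
  have hpr := fun k => isProbabilityMeasure_expMeasure_one_div (hζ k)
  have hnn := pi_expMeasure_ae_nonneg hζ
  have key := lintegral_one_div_sum_add_one (P := Measure.pi fun k => expMeasure (1 / ζ k))
    (V := fun k ψ => ψ k) (fun k => measurable_pi_apply k)
    (iIndepFun_pi (X := fun _ => id) fun _ => aemeasurable_id) hnn (fun k => (hζ k).le)
    (fun k s hs => by
      have h1 := (measurePreserving_eval (fun k => expMeasure (1 / ζ k)) k).lintegral_comp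
        (f := fun x => ENNReal.ofReal (Real.exp (-(s * x)))) (by fun_prop)
      have h2 := lintegral_exp_neg_mul_expMeasure (one_div_pos.2 (hζ k)) hs
      rw [one_div_one_div] at h2
      exact h1.trans h2)
  have h0 : 0 ≤ ∫ s in Set.Ioi (0 : ℝ), Real.exp (-s) * ∏ k, (1 + s * ζ k)⁻¹ :=
    setIntegral_nonneg measurableSet_Ioi fun s hs =>
      mul_nonneg (Real.exp_pos _).le (Finset.prod_nonneg fun k _ => by
        have := mul_pos (Set.mem_Ioi.1 hs) (hζ k); positivity)
  rw [← ENNReal.ofReal_eq_ofReal_iff (meanRecip_nonneg hζ) h0, ← key, meanRecip,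
    ofReal_integral_eq_lintegral_ofReal]
  · refine Integrable.of_bound (C := 1) (Measurable.aestronglyMeasurable (by fun_prop)) ?_
    filter_upwards [ae_all_iff.2 hnn] with ψ hψ
    have hv : 0 ≤ ∑ k, ψ k := Finset.sum_nonneg fun k _ => hψ k
    rw [Real.norm_of_nonneg (by positivity), div_le_one (by positivity)]
    linarith
  · filter_upwards [ae_all_iff.2 hnn] with ψ hψ
    have hv : 0 ≤ ∑ k, ψ k := Finset.sum_nonneg fun k _ => hψ k
    simp only [Pi.zero_apply]
    positivity

/-! ### The closed form -/

theorem integral_exp_neg_mul_inv {z : ℝ} (hz : 0 < z) :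
    ∫ s in Set.Ioi (0 : ℝ), Real.exp (-s) * (1 + s * z)⁻¹ =
      z⁻¹ * (Real.exp (1 / z) * expIntegralE1 (1 / z)) := by
  -- the substitution `t = 1 + s z`
  have h1 := integral_comp_mul_left_Ioi
    (fun t => Real.exp (1 / z) * (Real.exp (-(1 / z) * (t + 1)) / (t + 1))) 0 hz
  have h2 : ∫ t in Set.Ioi (0 : ℝ), Real.exp (-(1 / z) * (t + 1)) / (t + 1) =
      expIntegralE1 (1 / z) := by
    have := (measurePreserving_add_right (volume : Measure ℝ) 1).setIntegral_preimage_emb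
      (measurableEmbedding_addRight 1) (fun t => Real.exp (-(1 / z) * t) / t) (Set.Ioi 1)
    rw [expIntegralE1, ← this]
    simp
  rw [mul_zero, integral_const_mul (Real.exp (1 / z))
    fun x => Real.exp (-(1 / z) * (x + 1)) / (x + 1), h2, smul_eq_mul] at h1
  rw [← h1]
  refine setIntegral_congr_fun measurableSet_Ioi fun s hs => ?_
  rw [← mul_div_assoc, ← Real.exp_add, div_eq_mul_inv]
  congr 2
  · field_simp; ring
  · ring

theorem integrableOn_exp_neg_mul_inv_pow {z : ℝ} (hz : 0 < z) (j : ℕ) :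
    IntegrableOn (fun s => Real.exp (-s) * ((1 + s * z) ^ j)⁻¹) (Set.Ioi 0) := by
  refine integrableOn_exp_neg_mul_of_bounded (by fun_prop) fun s hs => ?_
  have := mul_pos hs hz
  rw [abs_of_nonneg (by positivity)]
  exact inv_le_one_of_one_le₀ (one_le_pow₀ (by linarith))

/-- Integration by parts lowers the power of `1 + s z`. -/
theorem integral_exp_neg_mul_inv_pow_succ {z : ℝ} (hz : 0 < z) (j : ℕ) :
    ∫ s in Set.Ioi (0 : ℝ), Real.exp (-s) * ((1 + s * z) ^ (j + 2))⁻¹ =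
      ((j + 1) * z)⁻¹ *
        (1 - ∫ s in Set.Ioi (0 : ℝ), Real.exp (-s) * ((1 + s * z) ^ (j + 1))⁻¹) := by
  have hi := integrableOn_exp_neg_mul_inv_pow hz
  have hpos : ∀ s ∈ Set.Ici (0 : ℝ), 0 < 1 + s * z := fun s hs => by
    have := mul_nonneg (Set.mem_Ici.1 hs) hz.le
    linarith
  have hd : ∀ s ∈ Set.Ici (0 : ℝ),
      HasDerivAt (fun s => Real.exp (-s) * ((1 + s * z) ^ (j + 1))⁻¹)
        (-(Real.exp (-s) * ((1 + s * z) ^ (j + 1))⁻¹) -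
          ((j + 1) * z) * (Real.exp (-s) * ((1 + s * z) ^ (j + 2))⁻¹)) s := by
    intro s hs
    have hp := hpos s hs
    have h1 : HasDerivAt (fun s => 1 + s * z) z s := by
      simpa using ((hasDerivAt_id s).mul_const z).const_add 1
    have h2 := (h1.pow (j + 1)).inv (pow_ne_zero _ hp.ne')
    have h3 : HasDerivAt (fun s => Real.exp (-s)) (-Real.exp (-s)) s := by
      simpa using (hasDerivAt_neg s).exp
    refine (h3.mul h2).congr_deriv ?_
    change -Real.exp (-s) * ((1 + s * z) ^ (j + 1))⁻¹ + Real.exp (-s) *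
      (-(((j + 1 : ℕ) : ℝ) * (1 + s * z) ^ j * z) / ((1 + s * z) ^ (j + 1)) ^ 2) = _
    push_cast
    field_simp
    ring
  have hlim : Filter.Tendsto (fun s => Real.exp (-s) * ((1 + s * z) ^ (j + 1))⁻¹)
      Filter.atTop (nhds 0) := by
    refine squeeze_zero' ?_ ?_ Real.tendsto_exp_neg_atTop_nhds_zero
    · filter_upwards [Filter.eventually_ge_atTop 0] with s hs
      have := hpos s hs
      positivity
    · filter_upwards [Filter.eventually_ge_atTop 0] with s hs
      have := mul_nonneg hs hz.le
      exact mul_le_of_le_one_right (Real.exp_pos _).le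
        (inv_le_one_of_one_le₀ (one_le_pow₀ (by linarith)))
  have := integral_Ioi_of_hasDerivAt_of_tendsto' hd
    ((hi (j + 1)).neg.sub ((hi (j + 2)).const_mul _)) hlim
  have e := integral_sub (hi (j + 1)).neg ((hi (j + 2)).const_mul ((j + 1) * z))
  simp only [Pi.neg_apply] at e
  rw [e, integral_neg, integral_const_mul] at this
  simp only [neg_zero, Real.exp_zero, zero_mul, add_zero, one_pow, inv_one, mul_one] at this
  rw [eq_inv_mul_iff_mul_eq₀ (by positivity)]
  linarith

theorem integral_exp_neg_mul_inv_pow {z : ℝ} (hz : 0 < z) (j : ℕ) :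
    ∫ s in Set.Ioi (0 : ℝ), Real.exp (-s) * ((1 + s * z) ^ (j + 1))⁻¹ =
      (-1) ^ j * z⁻¹ ^ (j + 1) / (j.factorial : ℝ) *
        (Real.exp (1 / z) * expIntegralE1 (1 / z) -
          ∑ m ∈ Finset.range j, (-1) ^ m * z ^ (m + 1) * (m.factorial : ℝ)) := by
  induction j with
  | zero => simpa using integral_exp_neg_mul_inv hz
  | succ j ih =>
    rw [integral_exp_neg_mul_inv_pow_succ hz, ih, Finset.sum_range_succ, Nat.factorial_succ]
    have : ((-1 : ℝ) ^ j) * (-1) ^ j = 1 := by rw [← mul_pow]; simp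
    have hf : (j.factorial : ℝ) ≠ 0 := by positivity
    push_cast
    set B := Real.exp (1 / z) * expIntegralE1 (1 / z)
    set S := ∑ m ∈ Finset.range j, (-1) ^ m * z ^ (m + 1) * (m.factorial : ℝ)
    simp only [inv_pow]
    field_simp
    linear_combination (-z ^ (2 * j + 3) * (j.factorial : ℝ)) * this

theorem meanRecip_eq_closedForm {T : ℕ} (hT : 0 < T) {ζ : Fin T → ℝ} (hζ : ∀ k, 0 < ζ k) :
    meanRecip ζ = closedForm ζ := by
  have hz : ∀ h, 0 < distinctVal ζ h := fun h => by
    obtain ⟨k, hk⟩ := distinctVal_mem ζ h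
    exact hk ▸ hζ k
  rw [meanRecip_eq_integral hζ]
  have hexp : ∀ s ∈ Set.Ioi (0 : ℝ), Real.exp (-s) * ∏ k, (1 + s * ζ k)⁻¹ =
      ∑ h, ∑ j : Fin (mult ζ h), charCoeff ζ h j *
        (Real.exp (-s) * ((1 + s * distinctVal ζ h) ^ (j.1 + 1))⁻¹) := by
    intro s hs
    have hdet : (1 + s • Matrix.diagonal ζ).det = ∏ k, (1 + s * ζ k) := by
      have h1 : (1 + s • Matrix.diagonal ζ) = Matrix.diagonal fun k => 1 + s * ζ k := by
        rw [← Matrix.diagonal_one, ← Matrix.diagonal_smul, Matrix.diagonal_add]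
        rfl
      rw [h1, Matrix.det_diagonal]
    have := isCharCoeff_charCoeff hT ζ hζ s (by
      rw [hdet]
      refine Finset.prod_ne_zero_iff.2 fun k _ => ?_
      have := mul_pos (Set.mem_Ioi.1 hs) (hζ k)
      positivity)
    rw [Finset.prod_inv_distrib, ← hdet, this, Finset.mul_sum]
    refine Finset.sum_congr rfl fun h _ => ?_
    rw [Finset.mul_sum]
    exact Finset.sum_congr rfl fun j _ => by rw [div_eq_mul_inv]; ring
  rw [setIntegral_congr_fun measurableSet_Ioi hexp, closedForm, integral_finsetSum]
  · refine Finset.sum_congr rfl fun h _ => ?_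
    rw [integral_finsetSum]
    · refine Finset.sum_congr rfl fun j _ => ?_
      rw [integral_const_mul, integral_exp_neg_mul_inv_pow (hz h), mul_assoc]
    · exact fun j _ => (integrableOn_exp_neg_mul_inv_pow (hz h) _).const_mul _
  · exact fun h _ => integrable_finsetSum _ fun j _ =>
      (integrableOn_exp_neg_mul_inv_pow (hz h) _).const_mul _

/-! ### Subfamilies of an independent family -/

theorem iIndepFun_curry {Ω κ A E : Type*} [MeasurableSpace Ω] [MeasurableSpace E] {P : Measure Ω}
    {X : κ → A → Ω → E} (hX : ∀ k a, Measurable (X k a))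
    (h : iIndepFun (fun (q : κ × A) ω => X q.1 q.2 ω) P) :
    iIndepFun (fun k ω a => X k a ω) P := by
  have := h.isProbabilityMeasure
  have hp : ∀ k a, IsProbabilityMeasure (P.map (X k a)) := fun k a =>
    Measure.isProbabilityMeasure_map (hX k a).aemeasurable
  have hrow : ∀ k, P.map (fun ω a => X k a ω) = Measure.infinitePi fun a => P.map (X k a) :=
    fun k => (iIndepFun_iff_map_fun_eq_infinitePi_map (hX k)).1
      (h.precomp (g := fun a => (k, a)) (Prod.mk_right_injective k))
  rw [iIndepFun_iff_map_fun_eq_infinitePi_map (by fun_prop)]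
  simp_rw [hrow]
  rw [← Measure.infinitePi_map_curry (fun k a => P.map (X k a)),
    ← (iIndepFun_iff_map_fun_eq_infinitePi_map (X := fun (q : κ × A) ω => X q.1 q.2 ω)
      (fun q => hX q.1 q.2)).1 h,
    Measure.map_map (by fun_prop) (by fun_prop)]
  rfl

theorem indepFun_of_disjoint_range {Ω I A B E : Type*} [MeasurableSpace Ω] [MeasurableSpace E]
    [Fintype A] [Fintype B] {P : Measure Ω} {f : I → Ω → E}
    (hf : ∀ i, Measurable (f i)) (h : iIndepFun f P) (e : A → I) (e' : B → I)
    (hd : ∀ a b, e a ≠ e' b) :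
    IndepFun (fun ω a => f (e a) ω) (fun ω b => f (e' b) ω) P := by
  classical
  have h1 := h.indepFun_finset (Finset.univ.image e) (Finset.univ.image e') (by
    rw [Finset.disjoint_left]
    intro i hi hi'
    obtain ⟨a, -, rfl⟩ := Finset.mem_image.1 hi
    obtain ⟨b, -, hb⟩ := Finset.mem_image.1 hi'
    exact hd a b hb.symm) hf
  exact h1.comp
    (φ := fun g a => g ⟨e a, Finset.mem_image_of_mem e (Finset.mem_univ a)⟩)
    (ψ := fun g b => g ⟨e' b, Finset.mem_image_of_mem e' (Finset.mem_univ b)⟩)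
    (by fun_prop) (by fun_prop)

/-- Conditioning on one of two independent variables, for a nonnegative function of both. -/
theorem lintegral_indepFun {Ω E F : Type*} [MeasurableSpace Ω] [MeasurableSpace E]
    [MeasurableSpace F] {P : Measure Ω} [IsProbabilityMeasure P] {X : Ω → E} {Y : Ω → F}
    (hX : Measurable X) (hY : Measurable Y) (h : IndepFun X Y P) {f : E × F → ENNReal}
    (hf : Measurable f) :
    ∫⁻ ω, f (X ω, Y ω) ∂P = ∫⁻ ω, ∫⁻ ω', f (X ω, Y ω') ∂P ∂P := by
  have := Measure.isProbabilityMeasure_map (μ := P) hY.aemeasurable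
  rw [← lintegral_map (f := f) (g := fun ω => (X ω, Y ω)) hf (hX.prodMk hY),
    h.map_prod_eq_prod_map_map hX.aemeasurable hY.aemeasurable, lintegral_prod _ hf.aemeasurable,
    lintegral_map (by fun_prop) hX]
  refine lintegral_congr fun ω => ?_
  rw [lintegral_map (by fun_prop) hY]

/-! ### The standard complex Gaussian law -/

/-- The standard complex Gaussian law: independent real and imaginary parts with mean `0` and
variance `1 / 2`. -/
noncomputable def complexGaussian : Measure ℂ :=
  ((gaussianReal 0 (1 / 2)).prod (gaussianReal 0 (1 / 2))).map Complex.measurableEquivRealProd.symm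

instance : IsProbabilityMeasure complexGaussian :=
  Measure.isProbabilityMeasure_map (by fun_prop)

theorem map_eq_complexGaussian {Ω : Type*} [MeasurableSpace Ω] {P : Measure Ω}
    [IsProbabilityMeasure P] {Z : Ω → ℂ} (hZ : Measurable Z)
    (hind : IndepFun (fun ω => (Z ω).re) (fun ω => (Z ω).im) P)
    (hre : P.map (fun ω => (Z ω).re) = gaussianReal 0 (1 / 2))
    (him : P.map (fun ω => (Z ω).im) = gaussianReal 0 (1 / 2)) :
    P.map Z = complexGaussian := by
  have h1 := hind.map_prod_eq_prod_map_map (by fun_prop) (by fun_prop)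
  rw [hre, him] at h1
  rw [complexGaussian, ← h1, Measure.map_map (by fun_prop) (by fun_prop)]
  rfl

theorem integral_complexGaussian {E : Type*} [NormedAddCommGroup E] [NormedSpace ℝ E] (f : ℂ → E) :
    ∫ z, f z ∂complexGaussian =
      ∫ q, f ⟨q.1, q.2⟩ ∂(gaussianReal 0 (1 / 2)).prod (gaussianReal 0 (1 / 2)) := by
  rw [complexGaussian, MeasureTheory.integral_map_equiv]
  rfl

theorem charFun_complexGaussian (t : ℂ) :
    charFun complexGaussian t = Complex.exp (-(‖t‖ ^ 2 / 4 : ℝ)) := by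
  rw [charFun_apply, integral_complexGaussian]
  have e : ∀ q : ℝ × ℝ, Complex.exp ((inner ℝ (⟨q.1, q.2⟩ : ℂ) t : ℝ) * Complex.I) =
      Complex.exp (t.re * q.1 * Complex.I) * Complex.exp (t.im * q.2 * Complex.I) := by
    intro q
    rw [← Complex.exp_add, Complex.inner]
    congr 1
    simp
    ring
  simp_rw [e]
  rw [integral_prod_mul (fun x : ℝ => Complex.exp (t.re * x * Complex.I))
    (fun x : ℝ => Complex.exp (t.im * x * Complex.I)), ← charFun_apply_real, ← charFun_apply_real,
    charFun_gaussianReal, charFun_gaussianReal, ← Complex.exp_add, Complex.sq_norm,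
    Complex.normSq_apply]
  congr 1
  push_cast
  ring

/-- The standard complex Gaussian law is invariant under unit linear forms in independent
variables. -/
theorem map_sum_mul_eq_complexGaussian {Ω ι : Type*} [MeasurableSpace Ω] [Fintype ι]
    {P : Measure Ω} [IsProbabilityMeasure P] {Z : ι → Ω → ℂ} (hZ : ∀ i, Measurable (Z i))
    (hind : iIndepFun Z P) (hlaw : ∀ i, P.map (Z i) = complexGaussian) (u : ι → ℂ)
    (hu : ∑ i, ‖u i‖ ^ 2 = 1) :
    P.map (fun ω => ∑ i, u i * Z i ω) = complexGaussian := by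
  have := Measure.isProbabilityMeasure_map (μ := P) (f := fun ω => ∑ i, u i * Z i ω) (by fun_prop)
  refine Measure.ext_of_charFun ?_
  rw [iIndepFun.charFun_map_fun_sum_eq_prod (X := fun i ω => u i * Z i ω) (by fun_prop)
    (hind.comp (fun i z => u i * z) fun i => by fun_prop)]
  ext t
  rw [Finset.prod_apply]
  have e : ∀ i, charFun (P.map fun ω => u i * Z i ω) t =
      Complex.exp (-(‖u i‖ ^ 2 * ‖t‖ ^ 2 / 4 : ℝ)) := by
    intro i
    have h1 : (P.map fun ω => u i * Z i ω) = complexGaussian.map (fun z => u i * z) := by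
      rw [← hlaw i, Measure.map_map (by fun_prop) (hZ i)]
      rfl
    have h2 : charFun (complexGaussian.map (fun z => u i * z)) t =
        charFun complexGaussian (star (u i) * t) := by
      rw [charFun_apply, charFun_apply, integral_map (by fun_prop) (by fun_prop)]
      refine integral_congr_ae (Filter.Eventually.of_forall fun z => ?_)
      simp only [Complex.inner]
      congr 4
      simp
      ring
    rw [h1, h2, charFun_complexGaussian, norm_mul, norm_star, mul_pow]
  simp_rw [e]
  rw [charFun_complexGaussian, ← Complex.exp_sum]
  congr 1
  rw [Finset.sum_neg_distrib, ← Complex.ofReal_sum, ← Finset.sum_div, ← Finset.sum_mul, hu, one_mul]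

theorem integral_exp_neg_mul_sq_gaussianReal {s : ℝ} (hs : 0 ≤ s) :
    ∫ x, Real.exp (-(s * x ^ 2)) ∂gaussianReal 0 (1 / 2) = √(1 + s)⁻¹ := by
  rw [integral_gaussianReal_eq_integral_smul (by norm_num)]
  have e : ∀ x : ℝ, gaussianPDFReal 0 (1 / 2) x • Real.exp (-(s * x ^ 2)) =
      (√Real.pi)⁻¹ * Real.exp (-(1 + s) * x ^ 2) := by
    intro x
    have h2 : ((1 / 2 : NNReal) : ℝ) = 1 / 2 := by norm_num
    have h3 : 2 * Real.pi * (1 / 2) = Real.pi := by ring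
    rw [gaussianPDFReal, smul_eq_mul, mul_assoc, ← Real.exp_add, h2, h3]
    congr 2
    ring
  simp_rw [e]
  rw [integral_const_mul, integral_gaussian, ← Real.sqrt_inv, ← Real.sqrt_mul (by positivity)]
  congr 1
  have := Real.pi_pos
  field_simp

theorem integral_exp_neg_mul_normSq_complexGaussian {s : ℝ} (hs : 0 ≤ s) :
    ∫ z, Real.exp (-(s * ‖z‖ ^ 2)) ∂complexGaussian = (1 + s)⁻¹ := by
  rw [integral_complexGaussian]
  have e : ∀ q : ℝ × ℝ, Real.exp (-(s * ‖(⟨q.1, q.2⟩ : ℂ)‖ ^ 2)) =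
      Real.exp (-(s * q.1 ^ 2)) * Real.exp (-(s * q.2 ^ 2)) := by
    intro q
    rw [← Real.exp_add, Complex.sq_norm, Complex.normSq_mk]
    ring_nf
  simp_rw [e]
  rw [integral_prod_mul (fun x : ℝ => Real.exp (-(s * x ^ 2))) fun x : ℝ => Real.exp (-(s * x ^ 2)),
    integral_exp_neg_mul_sq_gaussianReal hs, Real.mul_self_sqrt (by positivity)]

theorem lintegral_exp_neg_mul_normSq_complexGaussian {s : ℝ} (hs : 0 ≤ s) :
    ∫⁻ z, ENNReal.ofReal (Real.exp (-(s * ‖z‖ ^ 2))) ∂complexGaussian =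
      ENNReal.ofReal (1 + s)⁻¹ := by
  rw [← integral_exp_neg_mul_normSq_complexGaussian hs, ofReal_integral_eq_lintegral_ofReal]
  · refine Integrable.of_bound (C := 1) (by fun_prop) (Filter.Eventually.of_forall fun z => ?_)
    rw [Real.norm_of_nonneg (Real.exp_pos _).le, Real.exp_le_one_iff]
    have : 0 ≤ s * ‖z‖ ^ 2 := by positivity
    linarith
  · exact Filter.Eventually.of_forall fun z => (Real.exp_pos _).le

theorem lintegral_normSq_complexGaussian :
    ∫⁻ z, ENNReal.ofReal (‖z‖ ^ 2) ∂complexGaussian = 1 := by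
  have h1 : ∫⁻ x, ENNReal.ofReal (x ^ 2) ∂gaussianReal 0 (1 / 2) = ENNReal.ofReal (1 / 2) := by
    have h2 : Integrable (fun x : ℝ => x ^ 2) (gaussianReal 0 (1 / 2)) :=
      (memLp_id_gaussianReal 2).integrable_sq
    rw [← ofReal_integral_eq_lintegral_ofReal h2 (Filter.Eventually.of_forall fun x => sq_nonneg x)]
    have h3 := variance_fun_id_gaussianReal (μ := 0) (v := 1 / 2)
    rw [variance_of_integral_eq_zero (by fun_prop) (by simp)] at h3
    rw [h3]
    simp
  rw [complexGaussian, lintegral_map_equiv]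
  have e : ∀ q : ℝ × ℝ, ENNReal.ofReal (‖Complex.measurableEquivRealProd.symm q‖ ^ 2) =
      ENNReal.ofReal (q.1 ^ 2) + ENNReal.ofReal (q.2 ^ 2) := by
    intro q
    rw [← ENNReal.ofReal_add (sq_nonneg _) (sq_nonneg _), Complex.sq_norm]
    congr 1
    change Complex.normSq ⟨q.1, q.2⟩ = _
    rw [Complex.normSq_mk]
    ring
  simp_rw [e]
  rw [lintegral_add_left (by fun_prop),
    measurePreserving_fst.lintegral_comp (f := fun x => ENNReal.ofReal (x ^ 2)) (by fun_prop),
    measurePreserving_snd.lintegral_comp (f := fun x => ENNReal.ofReal (x ^ 2)) (by fun_prop), h1,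
    ← ENNReal.ofReal_add (by norm_num) (by norm_num)]
  norm_num

/-! ### The zero-forcing receiver -/

theorem measurable_matrix_det {E : Type*} [MeasurableSpace E] {N : ℕ}
    {F : E → Matrix (Fin N) (Fin N) ℂ} (hF : ∀ i j, Measurable fun e => F e i j) :
    Measurable fun e => (F e).det := by
  simp_rw [Matrix.det_apply']
  fun_prop

theorem measurable_matrix_mul {E : Type*} [MeasurableSpace E] {a b c : ℕ}
    {F : E → Matrix (Fin a) (Fin b) ℂ} {F' : E → Matrix (Fin b) (Fin c) ℂ}
    (hF : ∀ i j, Measurable fun e => F e i j) (hF' : ∀ i j, Measurable fun e => F' e i j)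
    (i : Fin a) (j : Fin c) : Measurable fun e => (F e * F' e) i j := by
  simp_rw [Matrix.mul_apply]
  fun_prop

theorem measurable_matrix_inv {E : Type*} [MeasurableSpace E] {N : ℕ}
    {F : E → Matrix (Fin N) (Fin N) ℂ} (hF : ∀ i j, Measurable fun e => F e i j) (i j : Fin N) :
    Measurable fun e => (F e)⁻¹ i j := by
  simp_rw [Matrix.inv_def, Ring.inverse_eq_inv', Matrix.smul_apply, smul_eq_mul,
    Matrix.adjugate_apply]
  refine (measurable_matrix_det hF).inv.mul (measurable_matrix_det fun k l => ?_)
  simp_rw [Matrix.updateRow_apply]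
  split_ifs
  · exact measurable_const
  · exact hF k l

theorem measurable_zfReceiver {E : Type*} [MeasurableSpace E] {M N : ℕ}
    {F : E → Matrix (Fin M) (Fin N) ℂ} (hF : ∀ i j, Measurable fun e => F e i j)
    (i : Fin M) (j : Fin N) : Measurable fun e => zfReceiver (F e) i j := by
  refine measurable_matrix_mul hF (measurable_matrix_inv (measurable_matrix_mul ?_ hF)) i j
  exact fun i j => (Complex.continuous_conj.measurable).comp (hF j i)

theorem channel_apply {M N : ℕ} (H : Matrix (Fin M) (Fin N) ℂ) (β : Fin N → ℝ) (m : Fin M)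
    (c : Fin N) : channel H β m c = H m c * ((√(β c) : ℝ) : ℂ) := by
  rw [channel, Matrix.mul_diagonal]

theorem measurable_channel {E : Type*} [MeasurableSpace E] {M N : ℕ}
    {F : E → Matrix (Fin M) (Fin N) ℂ} (hF : ∀ i j, Measurable fun e => F e i j) (β : Fin N → ℝ)
    (i : Fin M) (j : Fin N) : Measurable fun e => channel (F e) β i j := by
  simp_rw [channel_apply]
  fun_prop

theorem measurable_normSq_toLp {E : Type*} [MeasurableSpace E] {M : ℕ} {F : E → Fin M → ℂ}
    (hF : ∀ i, Measurable fun e => F e i) : Measurable fun e => ‖WithLp.toLp 2 (F e)‖ ^ 2 := by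
  simp_rw [EuclideanSpace.norm_sq_eq]
  fun_prop

/-- If `Gᴴ G` is singular, its matrix inverse is `0` by convention and the receiver vanishes. -/
theorem zfReceiver_col_eq_zero {M N : ℕ} {G : Matrix (Fin M) (Fin N) ℂ}
    (hG : ¬IsUnit (G.conjTranspose * G).det) (n : Fin N) : (zfReceiver G).col n = 0 := by
  ext m
  rw [zfReceiver, Matrix.nonsing_inv_apply_not_isUnit _ hG, Matrix.mul_zero]
  rfl

/-- Zero forcing: the receiver inverts the channel. -/
theorem star_zfReceiver_col_dotProduct {M N : ℕ} {G : Matrix (Fin M) (Fin N) ℂ}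
    (hG : IsUnit (G.conjTranspose * G).det) (n c : Fin N) :
    star ((zfReceiver G).col n) ⬝ᵥ G.col c = if c = n then 1 else 0 := by
  have h1 : G.conjTranspose * zfReceiver G = 1 := by
    rw [zfReceiver, ← Matrix.mul_assoc, Matrix.mul_nonsing_inv _ hG]
  have h2 := congrArg star (congrFun (congrFun h1 c) n)
  rw [Matrix.mul_apply, star_sum, Matrix.one_apply] at h2
  simp only [Matrix.conjTranspose_apply, star_mul', star_star] at h2
  rw [dotProduct]
  simp only [Pi.star_apply, Matrix.col_apply]
  rw [Finset.sum_congr rfl fun m _ => mul_comm _ _, h2]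
  split_ifs <;> simp

theorem linearIndependent_col_of_isUnit {M N : ℕ} {G : Matrix (Fin M) (Fin N) ℂ}
    (hG : IsUnit (G.conjTranspose * G).det) : LinearIndependent ℂ G.col := by
  rw [← Matrix.mulVec_injective_iff]
  intro x y hxy
  have h1 : (G.conjTranspose * G)⁻¹ * G.conjTranspose * G = 1 := by
    rw [Matrix.mul_assoc, Matrix.nonsing_inv_mul _ hG]
  have h2 := congrArg (((G.conjTranspose * G)⁻¹ * G.conjTranspose).mulVec ·) hxy
  simpa only [Matrix.mulVec_mulVec, h1, Matrix.one_mulVec] using h2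

/-- The span of the channel vectors of all users except `n`. -/
noncomputable def otherSpan {M N : ℕ} (G : Matrix (Fin M) (Fin N) ℂ) (n : Fin N) :
    Submodule ℂ (EuclideanSpace ℂ (Fin M)) :=
  Submodule.span ℂ (Set.range fun c : {c // c ≠ n} => WithLp.toLp 2 (G.col c))

theorem finrank_orthogonal_otherSpan {M N : ℕ} {G : Matrix (Fin M) (Fin N) ℂ}
    (hG : IsUnit (G.conjTranspose * G).det) (n : Fin N) :
    (Module.finrank ℂ (otherSpan G n)ᗮ : ℝ) = M - N + 1 := by
  have hli : LinearIndependent ℂ fun c : {c // c ≠ n} => WithLp.toLp 2 (G.col c) :=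
    ((linearIndependent_col_of_isUnit hG).comp (fun c : {c // c ≠ n} => c.1)
      Subtype.val_injective).map' (WithLp.linearEquiv 2 ℂ (Fin M → ℂ)).symm.toLinearMap
      (LinearEquiv.ker _)
  have h1 : Module.finrank ℂ (otherSpan G n) = N - 1 := by
    rw [otherSpan, finrank_span_eq_card hli]
    simp
  have h2 := (otherSpan G n).finrank_add_finrank_orthogonal
  rw [h1, finrank_euclideanSpace_fin] at h2
  have h3 : 0 < N := n.pos
  have h4 : Module.finrank ℂ (otherSpan G n)ᗮ + N = M + 1 := by omega
  have h5 : (Module.finrank ℂ (otherSpan G n)ᗮ : ℝ) + N = M + 1 := by exact_mod_cast h4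
  linarith

/-- The receiver of user `n` is orthogonal to all other channel vectors `g c` and has inner
product `1` with `g n`, so the Cauchy-Schwarz inequality bounds its norm below by the inverse of
the distance from `g n` to the span of the others. -/
theorem inv_normSq_zfReceiver_le {M N : ℕ} {G : Matrix (Fin M) (Fin N) ℂ}
    (hG : IsUnit (G.conjTranspose * G).det) (n : Fin N) {ι : Type*} [Fintype ι]
    (b : OrthonormalBasis ι ℂ (otherSpan G n)ᗮ) :
    (‖WithLp.toLp 2 ((zfReceiver G).col n)‖ ^ 2)⁻¹ ≤
      ∑ i, ‖star (WithLp.ofLp (b i : EuclideanSpace ℂ (Fin M))) ⬝ᵥ G.col n‖ ^ 2 := by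
  set a : EuclideanSpace ℂ (Fin M) := WithLp.toLp 2 ((zfReceiver G).col n) with ha
  set g : EuclideanSpace ℂ (Fin M) := WithLp.toLp 2 (G.col n) with hg
  have hinner : ∀ c, inner ℂ a (WithLp.toLp 2 (G.col c)) = if c = n then (1 : ℂ) else 0 := by
    intro c
    rw [EuclideanSpace.inner_eq_star_dotProduct, dotProduct_comm]
    exact star_zfReceiver_col_dotProduct hG n c
  have hmem : a ∈ (otherSpan G n)ᗮ := by
    rw [otherSpan, Submodule.mem_orthogonal']
    intro u hu
    induction hu using Submodule.span_induction with
    | mem x hx =>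
      obtain ⟨c, rfl⟩ := hx
      exact (hinner c.1).trans (if_neg c.2)
    | zero => exact inner_zero_right _
    | add x y _ _ hx hy => rw [inner_add_right, hx, hy, add_zero]
    | smul r x _ hx => rw [inner_smul_right, hx, mul_zero]
  set q := (otherSpan G n)ᗮ.orthogonalProjectionOnto g with hq
  have h1 : inner ℂ (⟨a, hmem⟩ : (otherSpan G n)ᗮ) q = (1 : ℂ) := by
    rw [hq, Submodule.inner_orthogonalProjectionOnto_eq_of_mem_left]
    exact (hinner n).trans (if_pos rfl)
  have h2 : 1 ≤ ‖a‖ * ‖q‖ := by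
    have := norm_inner_le_norm (𝕜 := ℂ) (⟨a, hmem⟩ : (otherSpan G n)ᗮ) q
    rwa [h1, norm_one] at this
  have h3 : ‖q‖ ^ 2 =
      ∑ i, ‖star (WithLp.ofLp (b i : EuclideanSpace ℂ (Fin M))) ⬝ᵥ G.col n‖ ^ 2 := by
    rw [← b.sum_sq_norm_inner_right]
    refine Finset.sum_congr rfl fun i _ => ?_
    rw [hq, Submodule.inner_orthogonalProjectionOnto_eq_of_mem_left,
      EuclideanSpace.inner_eq_star_dotProduct, dotProduct_comm]
  rw [← h3]
  have h4 : 0 < ‖a‖ := by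
    by_contra h
    have : ‖a‖ = 0 := le_antisymm (not_lt.1 h) (norm_nonneg _)
    rw [this] at h2
    norm_num at h2
  rw [inv_le_iff_one_le_mul₀ (by positivity), mul_comm, ← mul_pow]
  exact one_le_pow₀ h2

/-- The mean of a squared unit linear form is `1`. -/
theorem lintegral_normSq_sum_mul {Ω ι : Type*} [MeasurableSpace Ω] [Fintype ι]
    {P : Measure Ω} [IsProbabilityMeasure P] {Z : ι → Ω → ℂ} (hZ : ∀ i, Measurable (Z i))
    (hind : iIndepFun Z P) (hlaw : ∀ i, P.map (Z i) = complexGaussian) (u : ι → ℂ)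
    (hu : ∑ i, ‖u i‖ ^ 2 = 1) :
    ∫⁻ ω, ENNReal.ofReal (‖∑ i, u i * Z i ω‖ ^ 2) ∂P = 1 := by
  rw [← lintegral_normSq_complexGaussian, ← map_sum_mul_eq_complexGaussian hZ hind hlaw u hu,
    lintegral_map (by fun_prop) (by fun_prop)]

/-- The `M × N` matrix with `n`-th column `y` and other columns `x`. -/
def insertCol {M N : ℕ} (n : Fin N) (x : {c : Fin N // c ≠ n} × Fin M → ℂ) (y : Fin M → ℂ) :
    Matrix (Fin M) (Fin N) ℂ :=
  fun m c => if h : c = n then y m else x (⟨c, h⟩, m)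

theorem otherSpan_channel_insertCol {M N : ℕ} (n : Fin N) (x : {c : Fin N // c ≠ n} × Fin M → ℂ)
    (y y' : Fin M → ℂ) (β : Fin N → ℝ) :
    otherSpan (channel (insertCol n x y) β) n = otherSpan (channel (insertCol n x y') β) n := by
  rw [otherSpan, otherSpan]
  congr 2
  ext c : 1
  congr 1
  ext m
  simp only [Matrix.col_apply, channel_apply, insertCol, dif_neg c.2]

/-- The mean of `1 / ‖a‖ ^ 2` is at most `β n * (M - N + 1)`, for `a` the zero-forcing receiver of
user `n`. Given the channels of the other users, `1 / ‖a‖ ^ 2` is at most the sum of `M - N + 1`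
squared unit linear forms in the channel of user `n`. -/
theorem lintegral_inv_normSq_zfReceiver_le {Ω : Type*} [MeasurableSpace Ω] {P : Measure Ω}
    [IsProbabilityMeasure P] {M N : ℕ} {K : Ω → Matrix (Fin M) (Fin N) ℂ}
    (hK : ∀ m c, Measurable fun ω => K ω m c)
    (hind : iIndepFun (fun (q : Fin M × Fin N) ω => K ω q.1 q.2) P)
    (hlaw : ∀ m c, P.map (fun ω => K ω m c) = complexGaussian) {β : Fin N → ℝ} (n : Fin N)
    (hβ : 0 < β n) :
    ∫⁻ ω, ENNReal.ofReal ((‖WithLp.toLp 2 ((zfReceiver (channel (K ω) β)).col n)‖ ^ 2)⁻¹) ∂P ≤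
      ENNReal.ofReal (β n * (M - N + 1)) := by
  have hsplit : ∀ ω, K ω = insertCol n (fun q => K ω q.2 q.1) (fun m => K ω m n) := by
    intro ω
    ext m c
    rw [insertCol]
    split_ifs with h
    · rw [h]
    · rfl
  have hXY : IndepFun (fun ω (q : {c : Fin N // c ≠ n} × Fin M) => K ω q.2 q.1)
      (fun ω m => K ω m n) P :=
    indepFun_of_disjoint_range (f := fun (q : Fin M × Fin N) ω => K ω q.1 q.2)
      (fun q => hK q.1 q.2) hind (fun q : {c : Fin N // c ≠ n} × Fin M => (q.2, q.1.1))
      (fun m : Fin M => (m, n)) fun a b h => a.1.2 (congrArg Prod.snd h)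
  set f : ({c : Fin N // c ≠ n} × Fin M → ℂ) × (Fin M → ℂ) → ENNReal := fun e =>
    ENNReal.ofReal
      ((‖WithLp.toLp 2 ((zfReceiver (channel (insertCol n e.1 e.2) β)).col n)‖ ^ 2)⁻¹) with hf
  have hfm : Measurable f := by
    refine (measurable_normSq_toLp fun m => measurable_zfReceiver
      (measurable_channel (fun i j => ?_) β) m n).inv.ennreal_ofReal
    simp only [insertCol]
    split_ifs <;> fun_prop
  have e1 : ∀ ω, ENNReal.ofReal
      ((‖WithLp.toLp 2 ((zfReceiver (channel (K ω) β)).col n)‖ ^ 2)⁻¹) =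
      f (fun q => K ω q.2 q.1, fun m => K ω m n) := fun ω => by
    conv_lhs => rw [hsplit ω]
  simp_rw [e1]
  rw [lintegral_indepFun (by fun_prop) (by fun_prop) hXY hfm]
  suffices h : ∀ x, ∫⁻ ω, f (x, fun m => K ω m n) ∂P ≤ ENNReal.ofReal (β n * (M - N + 1)) by
    refine (lintegral_mono fun ω => h _).trans ?_
    rw [lintegral_const, measure_univ, mul_one]
  intro x
  by_cases hx : ∃ y, IsUnit ((channel (insertCol n x y) β).conjTranspose *
      channel (insertCol n x y) β).det
  · obtain ⟨y₀, hy₀⟩ := hx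
    set W := (otherSpan (channel (insertCol n x y₀) β) n)ᗮ with hW
    have hdim := finrank_orthogonal_otherSpan hy₀ n
    let b := stdOrthonormalBasis ℂ W
    let u : Fin (Module.finrank ℂ W) → Fin M → ℂ := fun i m =>
      star (WithLp.ofLp (b i : EuclideanSpace ℂ (Fin M)) m)
    have hu : ∀ i, ∑ m, ‖u i m‖ ^ 2 = 1 := by
      intro i
      have h1 : ‖(b i : EuclideanSpace ℂ (Fin M))‖ ^ 2 = 1 := by
        rw [← Submodule.coe_norm, b.orthonormal.1 i, one_pow]
      rw [EuclideanSpace.norm_sq_eq] at h1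
      simpa only [u, norm_star] using h1
    have hb : ∀ ω, f (x, fun m => K ω m n) ≤
        ∑ i, ENNReal.ofReal (β n) * ENNReal.ofReal (‖∑ m, u i m * K ω m n‖ ^ 2) := by
      intro ω
      set G := channel (insertCol n x fun m => K ω m n) β with hGdef
      by_cases hG : IsUnit (G.conjTranspose * G).det
      · have hspan : (otherSpan G n)ᗮ = W := by
          rw [hW, otherSpan_channel_insertCol n x (fun m => K ω m n) y₀]
        have key : (‖WithLp.toLp 2 ((zfReceiver G).col n)‖ ^ 2)⁻¹ ≤
            ∑ i, ‖star (WithLp.ofLp (b i : EuclideanSpace ℂ (Fin M))) ⬝ᵥ G.col n‖ ^ 2 := by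
          have := inv_normSq_zfReceiver_le hG n (stdOrthonormalBasis ℂ (otherSpan G n)ᗮ)
          revert this
          simp only [b]
          rw [hspan]
          exact id
        have hterm : ∀ i, ‖star (WithLp.ofLp (b i : EuclideanSpace ℂ (Fin M))) ⬝ᵥ G.col n‖ ^ 2 =
            β n * ‖∑ m, u i m * K ω m n‖ ^ 2 := by
          intro i
          have h1 : star (WithLp.ofLp (b i : EuclideanSpace ℂ (Fin M))) ⬝ᵥ G.col n =
              ((√(β n) : ℝ) : ℂ) * ∑ m, u i m * K ω m n := by
            rw [dotProduct, Finset.mul_sum]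
            refine Finset.sum_congr rfl fun m _ => ?_
            rw [Matrix.col_apply, hGdef, channel_apply, insertCol, dif_pos rfl, Pi.star_apply]
            ring
          rw [h1, norm_mul, mul_pow, Complex.norm_real, Real.norm_of_nonneg (Real.sqrt_nonneg _),
            Real.sq_sqrt hβ.le]
        rw [Finset.sum_congr rfl fun i _ => hterm i] at key
        refine (ENNReal.ofReal_le_ofReal key).trans ?_
        rw [ENNReal.ofReal_sum_of_nonneg fun i _ => by positivity]
        exact Finset.sum_le_sum fun i _ => (ENNReal.ofReal_mul hβ.le).le
      · have : f (x, fun m => K ω m n) = 0 := by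
          simp only [hf]
          rw [← hGdef, zfReceiver_col_eq_zero hG]
          simp
        rw [this]
        exact zero_le
    refine (lintegral_mono hb).trans ?_
    rw [lintegral_finsetSum _ fun i _ => by fun_prop]
    have hi : ∀ i, ∫⁻ ω, ENNReal.ofReal (β n) * ENNReal.ofReal (‖∑ m, u i m * K ω m n‖ ^ 2) ∂P =
        ENNReal.ofReal (β n) := by
      intro i
      rw [lintegral_const_mul _ (by fun_prop), lintegral_normSq_sum_mul (fun m => hK m n)
        (hind.precomp (g := fun m => (m, n)) (Prod.mk_left_injective n)) (fun m => hlaw m n) _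
        (hu i), mul_one]
    simp_rw [hi]
    rw [Finset.sum_const, Finset.card_univ, Fintype.card_fin, nsmul_eq_mul, ← hdim,
      ENNReal.ofReal_mul hβ.le, ENNReal.ofReal_natCast, mul_comm]
  · have h0 : ∀ y, f (x, y) = 0 := by
      intro y
      simp only [hf]
      rw [zfReceiver_col_eq_zero fun h => hx ⟨y, h⟩]
      simp
    simp_rw [h0]
    simp

/-! ### The mean signal-to-interference-plus-noise ratio -/

theorem zfSINR_nonneg {M N L : ℕ} {p β : Fin N → Fin (L + 1) → ℝ}
    (hp : ∀ c (l : Fin L), 0 < p c l.succ) {n : Fin N} (hpn : 0 ≤ p n 0)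
    (K : Fin (L + 1) → Matrix (Fin M) (Fin N) ℂ) : 0 ≤ zfSINR p β K n :=
  div_nonneg hpn (add_nonneg (Finset.sum_nonneg fun l _ => Finset.sum_nonneg fun c _ =>
    mul_nonneg (hp c l).le (sq_nonneg _)) (sq_nonneg _))

theorem measurable_zfSINR {E : Type*} [MeasurableSpace E] {M N L : ℕ}
    (p β : Fin N → Fin (L + 1) → ℝ) {K : E → Fin (L + 1) → Matrix (Fin M) (Fin N) ℂ}
    (hK : ∀ l m c, Measurable fun e => K e l m c) (n : Fin N) :
    Measurable fun e => zfSINR p β (K e) n := by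
  have ha : ∀ m, Measurable fun e =>
      (zfReceiver (channel (K e 0) fun c => β c 0)).col n m := fun m =>
    measurable_zfReceiver (measurable_channel (hK 0) _) m n
  refine measurable_const.div (.add ?_ (measurable_normSq_toLp ha))
  refine Finset.measurable_fun_sum _ fun l _ => Finset.measurable_fun_sum _ fun c _ =>
    measurable_const.mul (Measurable.pow_const (Measurable.norm ?_) 2)
  simp only [dotProduct]
  exact Finset.measurable_fun_sum _ fun m _ =>
    (Complex.continuous_conj.measurable.comp (ha m)).mul (measurable_channel (hK l.succ) _ m c)

/-- Dividing by `‖a‖ ^ 2` normalizes the receiver and puts the ratio in the form `1 / (v + 1)`. -/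
theorem zfSINR_eq {M N L : ℕ} {p β : Fin N → Fin (L + 1) → ℝ} (hβ : ∀ c l, 0 < β c l)
    (K : Fin (L + 1) → Matrix (Fin M) (Fin N) ℂ) (n : Fin N) {a : Fin M → ℂ}
    (ha : a = (zfReceiver (channel (K 0) fun c => β c 0)).col n) (ha0 : a ≠ 0) :
    zfSINR p β K n = p n 0 * (‖WithLp.toLp 2 a‖ ^ 2)⁻¹ *
      (1 / (∑ q : Fin L × Fin N, p q.2 q.1.succ * β q.2 q.1.succ *
        ‖∑ m, star (a m) / (‖WithLp.toLp 2 a‖ : ℂ) * K q.1.succ m q.2‖ ^ 2 + 1)) := by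
  have hr : ‖WithLp.toLp 2 a‖ ≠ 0 := by
    rw [norm_ne_zero_iff]
    exact fun h => ha0 (congrArg WithLp.ofLp h)
  have h1 : ∀ (l : Fin L) (c : Fin N),
      p c l.succ * ‖star a ⬝ᵥ (channel (K l.succ) fun c => β c l.succ).col c‖ ^ 2 =
      ‖WithLp.toLp 2 a‖ ^ 2 * (p c l.succ * β c l.succ *
        ‖∑ m, star (a m) / (‖WithLp.toLp 2 a‖ : ℂ) * K l.succ m c‖ ^ 2) := by
    intro l c
    have h2 : star a ⬝ᵥ (channel (K l.succ) fun c => β c l.succ).col c =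
        (‖WithLp.toLp 2 a‖ : ℂ) * ((√(β c l.succ) : ℝ) : ℂ) *
          ∑ m, star (a m) / (‖WithLp.toLp 2 a‖ : ℂ) * K l.succ m c := by
      rw [dotProduct, Finset.mul_sum]
      refine Finset.sum_congr rfl fun m _ => ?_
      have hr' : (‖WithLp.toLp 2 a‖ : ℂ) ≠ 0 := Complex.ofReal_ne_zero.2 hr
      rw [Matrix.col_apply, channel_apply, Pi.star_apply]
      field_simp
    rw [h2, norm_mul, norm_mul, Complex.norm_real, Complex.norm_real, norm_norm,
      Real.norm_of_nonneg (Real.sqrt_nonneg _), mul_pow, mul_pow, Real.sq_sqrt (hβ c l.succ).le]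
    ring
  simp only [zfSINR, ← ha]
  simp_rw [h1, ← Finset.mul_sum]
  rw [Fintype.sum_prod_type]
  set S := ∑ l : Fin L, ∑ c : Fin N, p c l.succ * β c l.succ *
    ‖∑ m, star (a m) / (‖WithLp.toLp 2 a‖ : ℂ) * K l.succ m c‖ ^ 2
  rw [← mul_add_one, div_mul_eq_div_div, div_eq_mul_inv (p n 0), div_eq_mul_one_div (_ * _)]

theorem meanRecip_interference {N L : ℕ} {p β : Fin N → Fin (L + 1) → ℝ}
    (hζ : ∀ k, 0 < interference p β k) :
    meanRecip (interference p β) = ∫ s in Set.Ioi (0 : ℝ), Real.exp (-s) *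
      ∏ q : Fin L × Fin N, (1 + s * (p q.2 q.1.succ * β q.2 q.1.succ))⁻¹ := by
  rw [meanRecip_eq_integral hζ]
  congr 1
  ext s
  rw [← finProdFinEquiv.prod_comp]
  simp [interference]

theorem IsRayleigh.map_eq {Ω : Type*} [MeasurableSpace Ω] {P : Measure Ω} [IsProbabilityMeasure P]
    {M N L : ℕ} {H : Fin (L + 1) → Ω → Matrix (Fin M) (Fin N) ℂ} (hH : IsRayleigh P H)
    (l : Fin (L + 1)) (m : Fin M) (n : Fin N) :
    P.map (fun ω => H l ω m n) = complexGaussian :=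
  map_eq_complexGaussian (hH.measurable l m n) (hH.indep_re_im l m n) (hH.law_re l m n)
    (hH.law_im l m n)

/-- For unit `u`, the powers `|uᴴ h|²` over the interfering users are independent exponential
variables, so the interference has the law of `v`. -/
theorem lintegral_interference {Ω : Type*} [MeasurableSpace Ω] {P : Measure Ω}
    [IsProbabilityMeasure P] {M N L : ℕ} {H : Fin (L + 1) → Ω → Matrix (Fin M) (Fin N) ℂ}
    (hH : IsRayleigh P H) {p β : Fin N → Fin (L + 1) → ℝ} (hβ : ∀ c l, 0 < β c l)
    (hp : ∀ c (l : Fin L), 0 < p c l.succ) {u : Fin M → ℂ} (hu : ∑ m, ‖u m‖ ^ 2 = 1) :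
    ∫⁻ ω, ENNReal.ofReal (1 / (∑ q : Fin L × Fin N, p q.2 q.1.succ * β q.2 q.1.succ *
      ‖∑ m, u m * H q.1.succ ω m q.2‖ ^ 2 + 1)) ∂P =
      ENNReal.ofReal (meanRecip (interference p β)) := by
  have hζ : ∀ q : Fin L × Fin N, 0 < p q.2 q.1.succ * β q.2 q.1.succ := fun q =>
    mul_pos (hp _ _) (hβ _ _)
  have hmeas := hH.measurable
  rw [meanRecip_interference fun k => hζ _]
  refine lintegral_one_div_sum_add_one
    (V := fun (q : Fin L × Fin N) ω => p q.2 q.1.succ * β q.2 q.1.succ *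
      ‖∑ m, u m * H q.1.succ ω m q.2‖ ^ 2) (fun q => by fun_prop) ?_
    (fun q => Filter.Eventually.of_forall fun ω => mul_nonneg (hζ q).le (sq_nonneg _))
    (fun q => (hζ q).le) ?_
  · have h1 : iIndepFun (fun (r : (Fin L × Fin N) × Fin M) ω => H r.1.1.succ ω r.2 r.1.2) P :=
      hH.iIndep.precomp
        (g := fun r : (Fin L × Fin N) × Fin M => (r.1.1.succ, r.2, r.1.2)) fun r r' h => by
          simp only [Prod.mk.injEq, Fin.succ_inj] at h
          exact Prod.ext (Prod.ext h.1 h.2.2) h.2.1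
    have h2 := iIndepFun_curry (X := fun (q : Fin L × Fin N) (m : Fin M) ω => H q.1.succ ω m q.2)
      (fun q m => hmeas _ _ _) h1
    exact h2.comp (fun q h => p q.2 q.1.succ * β q.2 q.1.succ * ‖∑ m, u m * h m‖ ^ 2)
      fun q => by fun_prop
  · intro q s hs
    have hind : iIndepFun (fun m ω => H q.1.succ ω m q.2) P :=
      hH.iIndep.precomp (g := fun m : Fin M => (q.1.succ, m, q.2)) fun m m' h => by
        simpa using h
    have hlaw := map_sum_mul_eq_complexGaussian (fun m => hmeas q.1.succ m q.2) hind
      (fun m => hH.map_eq _ _ _) u hu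
    rw [← lintegral_exp_neg_mul_normSq_complexGaussian (mul_nonneg hs.le (hζ q).le), ← hlaw,
      lintegral_map (by fun_prop) (by fun_prop)]
    simp_rw [mul_assoc]

theorem zfSINR_eq_zero {M N L : ℕ} {p β : Fin N → Fin (L + 1) → ℝ}
    (K : Fin (L + 1) → Matrix (Fin M) (Fin N) ℂ) (n : Fin N)
    (ha : (zfReceiver (channel (K 0) fun c => β c 0)).col n = 0) : zfSINR p β K n = 0 := by
  simp [zfSINR, ha]

/-- The fast fading matrices of all cells, from the entries `x` for the central cell and `y` for
the interfering cells. -/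
def joinCells {M N L : ℕ} (x : Fin M × Fin N → ℂ) (y : Fin L × Fin M × Fin N → ℂ)
    (l : Fin (L + 1)) : Matrix (Fin M) (Fin N) ℂ :=
  Fin.cases (motive := fun _ => Matrix (Fin M) (Fin N) ℂ) (fun m c => x (m, c))
    (fun l m c => y (l, m, c)) l

theorem joinCells_zero {M N L : ℕ} (x : Fin M × Fin N → ℂ) (y : Fin L × Fin M × Fin N → ℂ)
    (m : Fin M) (c : Fin N) : joinCells x y 0 m c = x (m, c) := rfl

theorem joinCells_succ {M N L : ℕ} (x : Fin M × Fin N → ℂ) (y : Fin L × Fin M × Fin N → ℂ)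
    (l : Fin L) (m : Fin M) (c : Fin N) : joinCells x y l.succ m c = y (l, m, c) := rfl

/-- The conditional mean of the SINR, given the channel of the central cell. -/
theorem lintegral_zfSINR_joinCells {Ω : Type*} [MeasurableSpace Ω] {P : Measure Ω}
    [IsProbabilityMeasure P] {M N L : ℕ} {H : Fin (L + 1) → Ω → Matrix (Fin M) (Fin N) ℂ}
    (hH : IsRayleigh P H) {p β : Fin N → Fin (L + 1) → ℝ} (hβ : ∀ c l, 0 < β c l)
    (hp : ∀ c (l : Fin L), 0 < p c l.succ) {n : Fin N} (hpn : 0 ≤ p n 0)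
    (x : Fin M × Fin N → ℂ) {a : Fin M → ℂ}
    (ha : a = (zfReceiver (channel (fun m c => x (m, c)) fun c => β c 0)).col n) :
    ∫⁻ ω, ENNReal.ofReal (zfSINR p β
      (joinCells x fun r : Fin L × Fin M × Fin N => H r.1.succ ω r.2.1 r.2.2) n) ∂P =
      ENNReal.ofReal (p n 0) * ENNReal.ofReal (meanRecip (interference p β)) *
        ENNReal.ofReal ((‖WithLp.toLp 2 a‖ ^ 2)⁻¹) := by
  have hmeas := hH.measurable
  by_cases ha0 : a = 0
  · -- a vanishing receiver makes the denominators on both sides `0`, and `t / 0 = 0`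
    have h0 : ∀ y : Fin L × Fin M × Fin N → ℂ, zfSINR p β (joinCells x y) n = 0 := fun y =>
      zfSINR_eq_zero _ n (ha.symm.trans ha0)
    simp [h0, ha0]
  · have hr : ‖WithLp.toLp 2 a‖ ≠ 0 := by
      rw [norm_ne_zero_iff]
      exact fun h => ha0 (congrArg WithLp.ofLp h)
    have hu : ∑ m, ‖star (a m) / (‖WithLp.toLp 2 a‖ : ℂ)‖ ^ 2 = 1 := by
      simp_rw [norm_div, norm_star, Complex.norm_real, norm_norm, div_pow]
      rw [← Finset.sum_div, ← EuclideanSpace.norm_sq_eq (WithLp.toLp 2 a),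
        div_self (pow_ne_zero 2 hr)]
    have h1 := fun y : Fin L × Fin M × Fin N → ℂ =>
      zfSINR_eq (p := p) hβ (joinCells x y) n (a := a) ha ha0
    simp_rw [h1, joinCells_succ]
    simp_rw [ENNReal.ofReal_mul (show 0 ≤ p n 0 * (‖WithLp.toLp 2 a‖ ^ 2)⁻¹ by positivity)]
    rw [lintegral_const_mul _ (by fun_prop), lintegral_interference hH hβ hp hu,
      ENNReal.ofReal_mul hpn]
    ring

theorem lintegral_zfSINR_le {Ω : Type*} [MeasurableSpace Ω] {P : Measure Ω}
    [IsProbabilityMeasure P] {M N L : ℕ} {H : Fin (L + 1) → Ω → Matrix (Fin M) (Fin N) ℂ}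
    (hH : IsRayleigh P H) {p β : Fin N → Fin (L + 1) → ℝ} (hβ : ∀ c l, 0 < β c l)
    (hp : ∀ c (l : Fin L), 0 < p c l.succ) {n : Fin N} (hpn : 0 ≤ p n 0) :
    ∫⁻ ω, ENNReal.ofReal (zfSINR p β (fun l => H l ω) n) ∂P ≤
      ENNReal.ofReal (p n 0) * ENNReal.ofReal (meanRecip (interference p β)) *
        ENNReal.ofReal (β n 0 * (M - N + 1)) := by
  have hmeas := hH.measurable
  have hXY : IndepFun (fun ω (q : Fin M × Fin N) => H 0 ω q.1 q.2)
      (fun ω (r : Fin L × Fin M × Fin N) => H r.1.succ ω r.2.1 r.2.2) P :=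
    indepFun_of_disjoint_range
      (f := fun (i : Fin (L + 1) × Fin M × Fin N) ω => H i.1 ω i.2.1 i.2.2)
      (fun i => hmeas _ _ _) hH.iIndep (fun q => (0, q))
      (fun r : Fin L × Fin M × Fin N => (r.1.succ, r.2))
      fun q r h => Fin.succ_ne_zero r.1 (congrArg Prod.fst h).symm
  have hK : ∀ l m c, Measurable
      fun e : (Fin M × Fin N → ℂ) × (Fin L × Fin M × Fin N → ℂ) => joinCells e.1 e.2 l m c := by
    intro l m c
    refine Fin.cases ?_ (fun l => ?_) l
    · simp only [joinCells_zero]; fun_prop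
    · simp only [joinCells_succ]; fun_prop
  have hKH : ∀ ω, (fun l => H l ω) =
      joinCells (fun q => H 0 ω q.1 q.2) (fun r => H r.1.succ ω r.2.1 r.2.2) := by
    intro ω
    ext l m c
    refine Fin.cases ?_ (fun l => ?_) l
    · rw [joinCells_zero]
    · rw [joinCells_succ]
  simp_rw [hKH]
  rw [lintegral_indepFun (f := fun e => ENNReal.ofReal (zfSINR p β (joinCells e.1 e.2) n))
    (by fun_prop) (by fun_prop) hXY (measurable_zfSINR p β hK n).ennreal_ofReal]
  dsimp only
  rw [lintegral_congr fun ω => lintegral_zfSINR_joinCells hH hβ hp hpn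
    (fun q => H 0 ω q.1 q.2) (a := (zfReceiver (channel (H 0 ω) fun c => β c 0)).col n) rfl]
  rw [lintegral_const_mul' _ _ (ENNReal.mul_ne_top ENNReal.ofReal_ne_top ENNReal.ofReal_ne_top)]
  gcongr
  exact lintegral_inv_normSq_zfReceiver_le (hmeas 0)
    (hH.iIndep.precomp (g := fun q : Fin M × Fin N => ((0 : Fin (L + 1)), q))
      (Prod.mk_right_injective 0)) (fun m c => hH.map_eq 0 m c) n (hβ n 0)

/-- Jensen's inequality for `x ↦ logb 2 (1 + x)`, in the form of its tangent line at `c`, with the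
integrability that it needs. -/
theorem integrable_logb_and_integral_le {Ω : Type*} [MeasurableSpace Ω] {P : Measure Ω}
    [IsProbabilityMeasure P] {X : Ω → ℝ} (hX : Measurable X) (hX0 : ∀ ω, 0 ≤ X ω) {c : ℝ}
    (hc : 0 ≤ c) (hle : ∫⁻ ω, ENNReal.ofReal (X ω) ∂P ≤ ENNReal.ofReal c) :
    Integrable (fun ω => Real.logb 2 (1 + X ω)) P ∧
      ∫ ω, Real.logb 2 (1 + X ω) ∂P ≤ Real.logb 2 (1 + c) := by
  have hXi : Integrable X P := ⟨hX.aestronglyMeasurable, by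
    rw [hasFiniteIntegral_iff_ofReal (Filter.Eventually.of_forall hX0)]
    exact hle.trans_lt ENNReal.ofReal_lt_top⟩
  have hXc : ∫ ω, X ω ∂P ≤ c := by
    rwa [← ENNReal.ofReal_le_ofReal_iff hc,
      ofReal_integral_eq_lintegral_ofReal hXi (Filter.Eventually.of_forall hX0)]
  have htangent : ∀ ω, Real.log (1 + X ω) ≤ Real.log (1 + c) + (X ω - c) / (1 + c) := by
    intro ω
    have h1 : 0 < 1 + X ω := by linarith [hX0 ω]
    have h2 : 0 < 1 + c := by linarith
    have h3 := Real.log_le_sub_one_of_pos (div_pos h1 h2)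
    rw [Real.log_div h1.ne' h2.ne'] at h3
    have h4 : (1 + X ω) / (1 + c) - 1 = (X ω - c) / (1 + c) := by field_simp; ring
    linarith
  have hlog : Integrable (fun ω => Real.log (1 + X ω)) P := by
    refine hXi.mono' (Measurable.aestronglyMeasurable (by fun_prop))
      (Filter.Eventually.of_forall fun ω => ?_)
    have h1 : 0 < 1 + X ω := by linarith [hX0 ω]
    rw [Real.norm_of_nonneg (Real.log_nonneg (by linarith [hX0 ω]))]
    linarith [Real.log_le_sub_one_of_pos h1]
  refine ⟨hlog.div_const _, ?_⟩
  simp only [Real.logb]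
  rw [integral_div]
  refine div_le_div_of_nonneg_right ?_ (Real.log_nonneg (by norm_num))
  have h5 : Integrable (fun ω => (X ω - c) / (1 + c)) P :=
    (hXi.sub (integrable_const c)).div_const _
  refine (integral_mono hlog ((integrable_const _).add h5) htangent).trans ?_
  have e : ∫ ω, (Real.log (1 + c) + (X ω - c) / (1 + c)) ∂P =
      Real.log (1 + c) + (∫ ω, X ω ∂P - c) / (1 + c) := by
    rw [integral_add (integrable_const _) h5, integral_div, integral_sub hXi (integrable_const c)]
    simp
  refine e.le.trans ?_
  have : (∫ ω, X ω ∂P - c) / (1 + c) ≤ 0 :=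
    div_nonpos_of_nonpos_of_nonneg (by linarith) (by linarith)
  linarith

theorem theorem3 {Ω : Type*} [MeasurableSpace Ω] (P : Measure Ω) [IsProbabilityMeasure P]
    {M N L : ℕ} (hMN : N ≤ M) (hL : 0 < L)
    (H : Fin (L + 1) → Ω → Matrix (Fin M) (Fin N) ℂ) (hH : IsRayleigh P H)
    (p β : Fin N → Fin (L + 1) → ℝ) (hβ : ∀ c l, 0 < β c l)
    (hp : ∀ c (l : Fin L), 0 < p c l.succ) (n : Fin N) (hpn : 0 ≤ p n 0) :
    Integrable (fun ω => Real.logb 2 (1 + zfSINR p β (fun l => H l ω) n)) P ∧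
    zfUplinkRate P p β H n ≤
      Real.logb 2 (1 + p n 0 * β n 0 * ((M : ℝ) - N + 1) * meanRecip (interference p β)) ∧
    meanRecip (interference p β) = closedForm (interference p β) ∧
    zfUplinkRate P p β H n ≤
      Real.logb 2 (1 + p n 0 * β n 0 * ((M : ℝ) - N + 1) * closedForm (interference p β)) := by
  have hζ : ∀ k, 0 < interference p β k := fun k => mul_pos (hp _ _) (hβ _ _)
  have hclosed := meanRecip_eq_closedForm (Nat.mul_pos hL n.pos) hζ
  have hr := meanRecip_nonneg hζ
  have hM : (0 : ℝ) ≤ (M : ℝ) - N + 1 := by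
    have : (N : ℝ) ≤ M := by exact_mod_cast hMN
    linarith
  have hb := hβ n 0
  have hle := lintegral_zfSINR_le hH hβ hp hpn
  rw [← ENNReal.ofReal_mul hpn, ← ENNReal.ofReal_mul (mul_nonneg hpn hr)] at hle
  obtain ⟨h1, h2⟩ := integrable_logb_and_integral_le
    (measurable_zfSINR p β (K := fun ω l => H l ω) hH.measurable n)
    (fun ω => zfSINR_nonneg hp hpn _) (by positivity) hle
  have h3 : zfUplinkRate P p β H n ≤
      Real.logb 2 (1 + p n 0 * β n 0 * ((M : ℝ) - N + 1) * meanRecip (interference p β)) := by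
    refine h2.trans_eq ?_
    congr 2
    ring
  exact ⟨h1, h3, hclosed, hclosed ▸ h3⟩
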